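/- Let $d\ge 1$ be an integer, $1\le p<\infty$, and let $\nu:\mathbb R^d\setminus\{0\}\to[0,\infty]$ be measurable. For an open set $\Omega\subset\mathbb R^d$ put $$|u|_{W^p_\nu(\Omega)}=\Big(\iint_{\Omega\times\Omega}|u(x)-u(y)|^p\,\nu(x-y)\,dy\,dx\Big)^{1/p},\qquad W^p_\nu(\Omega)=\{u\in L^p(\Omega):|u|_{W^p_\nu(\Omega)}<\infty\},$$ with norm $\|u\|_{W^p_\nu(\Omega)}=(\|u\|_{L^p(\Omega)}^p+|u|_{W^p_\nu(\Omega)}^p)^{1/p}$. An open set $\Omega$ is a *$W^p_\nu$-extension domain* if there are a linear operator $E:W^p_\nu(\Omega)\to W^p_\nu(\mathbb R^d)$ and a constant $C$ such that $Eu|_\Omega=u$ and $\|Eu\|_{W^p_\nu(\mathbb R^d)}\le C\|u\|_{W^p_\nu(\Omega)}$ for all $u\in W^p_\nu(\Omega)$. The kernel $\nu$ is *almost decreasing* if there is $\kappa\in(0,1]$ with $\kappa\,\nu(x)\le\nu(y)$ whenever $|x|\ge|y|>0$. Let $c_d=|B(0,1)|$, $\eta(r)=(r/c_d)^{1/d}$,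 and $$\nu^*(\rho)=\inf\{s>0:|\{\nu>s\}|\le c_d\rho^d\},\qquad \nu^\#(r)=\int_{\{\nu<\nu^*(\eta(r))\}}\nu(h)\,dh,$$ and let $w:[0,\infty]\to[0,\infty]$ be $w(r)=(r\,\nu^\#(r))^{1/p}$ for $0<r<\infty$, with $w(0)=0$ and $w(\infty)=\infty$. A *Young function* is a convex function $[0,\infty]\to[0,\infty]$ that vanishes at $0$. Assume that * $w$ is a bijection of $[0,\infty]$ onto itself; set $\phi(t)=1/w^{-1}(1/t)$, where $1/0=\infty$ and $1/\infty=0$; * $t\mapsto\phi(t^{1/p})$ is a Young function; * there is $\theta>0$ such that $\phi(\theta s/t)\le\phi(s)/\phi(t)$ for all $0\le s\le t$ with $0<t<\infty$. Let $L^\phi(\Omega)$ be the space of measurable $u:\Omega\to\mathbb R$ with $\int_\Omega\phi(|u|/\lambda)\,dx<\infty$ for some $\lambda>0$, with the Luxemburg norm $\|u\|_{L^\phi(\Omega)}=\inf\{\lambda>0:\int_\Omega\phi(|u|/\lambda)\,dx\le1\}$, and write $u_\Omega=\frac1{|\Omega|}\int_\Omega u\,dx$. **Claim.** If $\nu$ is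 almost decreasing and $\Omega\subset\mathbb R^d$ is a nonempty bounded $W^p_\nu$-extension domain, then there is a constant $C=C(\Omega,\nu,p,d)>0$ such that every $u\in L^\phi(\Omega)$ is integrable on $\Omega$ and satisfies $$\big\|u-u_\Omega\big\|_{L^\phi(\Omega)}\le C\Big(\iint_{\Omega\times\Omega}|u(x)-u(y)|^p\,\nu(x-y)\,dy\,dx\Big)^{1/p}.$$ In particular, let $s\in(0,1)$ and let $p^*_s$, given by $\frac1{p^*_s}=\frac1p-\frac sd$, be positive. If $\Omega$ is a nonempty bounded $W^p_\nu$-extension domain for $\nu(h)=|h|^{-d-sp}$, then there is a constant $C=C(\Omega,s,p,d)>0$ such that every $u\in L^{p^*_s}(\Omega)$ is integrable on $\Omega$ and satisfies $$\big\|u-u_\Omega\big\|_{L^{p^*_s}(\Omega)}\le C\Big(\iint_{\Omega\times\Omega}\frac{|u(x)-u(y)|^p}{|x-y|^{d+sp}}\,dy\,dx\Big)^{1/p}.$$ -/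

import Mathlib

open MeasureTheory Set
open scoped ENNReal NNReal

noncomputable section

/-- The power `|u|_{W^p_ν(Ω)}^p = ∬_{Ω×Ω} |u(x) - u(y)|^p ν(x - y) dy dx` of the nonlocal Sobolev
seminorm. A kernel on `ℝ^d ∖ {0}` is modelled by a function on `ℝ^d` whose value at `0` plays no
role. -/
def nonlocalEnergy {d : ℕ} (p : ℝ) (ν : EuclideanSpace ℝ (Fin d) → ℝ≥0∞)
    (Ω : Set (EuclideanSpace ℝ (Fin d))) (u : EuclideanSpace ℝ (Fin d) → ℝ) : ℝ≥0∞ :=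
  ∫⁻ x in Ω, ∫⁻ y in Ω, ‖u x - u y‖ₑ ^ p * ν (x - y)

/-- The seminorm `|u|_{W^p_ν(Ω)}`, with value `∞` allowed. -/
def nonlocalSeminorm {d : ℕ} (p : ℝ) (ν : EuclideanSpace ℝ (Fin d) → ℝ≥0∞)
    (Ω : Set (EuclideanSpace ℝ (Fin d))) (u : EuclideanSpace ℝ (Fin d) → ℝ) : ℝ≥0∞ :=
  nonlocalEnergy p ν Ω u ^ (1 / p)

/-- `u ∈ W^p_ν(Ω)`: `u ∈ L^p(Ω)` and the seminorm is finite. -/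
def MemNonlocalSobolev {d : ℕ} (p : ℝ) (ν : EuclideanSpace ℝ (Fin d) → ℝ≥0∞)
    (Ω : Set (EuclideanSpace ℝ (Fin d))) (u : EuclideanSpace ℝ (Fin d) → ℝ) : Prop :=
  MemLp u (ENNReal.ofReal p) (volume.restrict Ω) ∧ nonlocalSeminorm p ν Ω u < ∞

/-- The norm `(‖u‖_{L^p(Ω)}^p + |u|_{W^p_ν(Ω)}^p)^{1/p}` of `W^p_ν(Ω)`. -/
def nonlocalSobolevNorm {d : ℕ} (p : ℝ) (ν : EuclideanSpace ℝ (Fin d) → ℝ≥0∞)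
    (Ω : Set (EuclideanSpace ℝ (Fin d))) (u : EuclideanSpace ℝ (Fin d) → ℝ) : ℝ≥0∞ :=
  (eLpNorm u (ENNReal.ofReal p) (volume.restrict Ω) ^ p + nonlocalSeminorm p ν Ω u ^ p) ^ (1 / p)

/-- `Ω` is a `W^p_ν`-extension domain. Elements of the Sobolev spaces are represented by functions,
so restriction and linearity are meant almost everywhere; linearity and the norm bound make the
operator compatible with almost everywhere equality. -/
def IsExtensionDomain {d : ℕ} (p : ℝ) (ν : EuclideanSpace ℝ (Fin d) → ℝ≥0∞)
    (Ω : Set (EuclideanSpace ℝ (Fin d))) : Prop :=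
  IsOpen Ω ∧
  ∃ (T : (EuclideanSpace ℝ (Fin d) → ℝ) → (EuclideanSpace ℝ (Fin d) → ℝ)) (C : ℝ≥0),
    (∀ u v, MemNonlocalSobolev p ν Ω u → MemNonlocalSobolev p ν Ω v → ∀ a b : ℝ,
      T (a • u + b • v) =ᵐ[volume] a • T u + b • T v) ∧
    ∀ u, MemNonlocalSobolev p ν Ω u →
      MemNonlocalSobolev p ν univ (T u) ∧
      T u =ᵐ[volume.restrict Ω] u ∧
      nonlocalSobolevNorm p ν univ (T u) ≤ C * nonlocalSobolevNorm p ν Ω u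

/-- The radial profile of the symmetric rearrangement,
`ν^*(ρ) = inf {s > 0 : |{ν > s}| ≤ c_d ρ^d}` with `c_d = |B(0,1)|`. -/
def symmRearrangement {d : ℕ} (ν : EuclideanSpace ℝ (Fin d) → ℝ≥0∞) (ρ : ℝ≥0∞) : ℝ≥0∞ :=
  sInf {s : ℝ≥0∞ | 0 < s ∧ volume {h | s < ν h} ≤
    volume (Metric.ball (0 : EuclideanSpace ℝ (Fin d)) 1) * ρ ^ d}

/-- The radius `η(r) = (r / c_d)^{1/d}` of a ball of volume `r` in `ℝ^d`. -/
def ballRadius (d : ℕ) (r : ℝ≥0∞) : ℝ≥0∞ :=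
  (r / volume (Metric.ball (0 : EuclideanSpace ℝ (Fin d)) 1)) ^ (1 / (d : ℝ))

/-- `ν^#(r) = ∫_{ν < ν^*(η(r))} ν(h) dh`. -/
def kernelSharp {d : ℕ} (ν : EuclideanSpace ℝ (Fin d) → ℝ≥0∞) (r : ℝ≥0∞) : ℝ≥0∞ :=
  ∫⁻ h in {h | ν h < symmRearrangement ν (ballRadius d r)}, ν h

/-- `w(r) = (r ν^#(r))^{1/p}` on `[0, ∞]`, with the endpoint value `w(∞) = ∞`; the endpoint value
`w(0) = 0` is given by the formula, since `0 * ∞ = 0`. -/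
def kernelW {d : ℕ} (p : ℝ) (ν : EuclideanSpace ℝ (Fin d) → ℝ≥0∞) (r : ℝ≥0∞) : ℝ≥0∞ :=
  if r = ∞ then ∞ else (r * kernelSharp ν r) ^ (1 / p)

/-- The critical function `φ(t) = 1 / w⁻¹(1 / t)`, with `1 / 0 = ∞` and `1 / ∞ = 0`; used when `w`
is a bijection of `[0, ∞]`. -/
def criticalFunction {d : ℕ} (p : ℝ) (ν : EuclideanSpace ℝ (Fin d) → ℝ≥0∞) (t : ℝ≥0∞) : ℝ≥0∞ :=
  (Function.invFun (kernelW p ν) t⁻¹)⁻¹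

/-- A Young function: a convex `φ : [0, ∞] → [0, ∞]` with `φ(0) = 0`. -/
def IsYoungFunction (φ : ℝ≥0∞ → ℝ≥0∞) : Prop :=
  φ 0 = 0 ∧ ConvexOn ℝ≥0 univ φ

/-- `u` belongs to the Orlicz space `L^φ(Ω)`. -/
def MemOrlicz {d : ℕ} (φ : ℝ≥0∞ → ℝ≥0∞) (Ω : Set (EuclideanSpace ℝ (Fin d)))
    (u : EuclideanSpace ℝ (Fin d) → ℝ) : Prop :=
  AEStronglyMeasurable u (volume.restrict Ω) ∧
    ∃ l : ℝ≥0, 0 < l ∧ ∫⁻ x in Ω, φ (‖u x‖ₑ / l) < ∞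

/-- The Luxemburg norm `‖u‖_{L^φ(Ω)} = inf {l > 0 : ∫_Ω φ(|u| / l) ≤ 1}` (`inf ∅ = ∞`). -/
def luxemburgNorm {d : ℕ} (φ : ℝ≥0∞ → ℝ≥0∞) (Ω : Set (EuclideanSpace ℝ (Fin d)))
    (u : EuclideanSpace ℝ (Fin d) → ℝ) : ℝ≥0∞ :=
  ⨅ (l : ℝ≥0) (_ : 0 < l ∧ ∫⁻ x in Ω, φ (‖u x‖ₑ / l) ≤ 1), (l : ℝ≥0∞)

/-- `ν` is almost decreasing: `κ ν(x) ≤ ν(y)` whenever `|x| ≥ |y| > 0`, for some `κ ∈ (0, 1]`. -/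
def AlmostDecreasing {d : ℕ} (ν : EuclideanSpace ℝ (Fin d) → ℝ≥0∞) : Prop :=
  ∃ κ : ℝ≥0, 0 < κ ∧ κ ≤ 1 ∧
    ∀ x y : EuclideanSpace ℝ (Fin d), y ≠ 0 → ‖y‖ ≤ ‖x‖ → κ * ν x ≤ ν y

/-- The hypotheses on the kernel: `ν` is Lebesgue measurable, `w` is a bijection of `[0, ∞]`,
`t ↦ φ(t^{1/p})` is a Young function, and `φ(θ s / t) ≤ φ(s) / φ(t)` for `0 ≤ s ≤ t`, for some
`θ > 0`. -/
structure CriticalKernel {d : ℕ} (p : ℝ) (ν : EuclideanSpace ℝ (Fin d) → ℝ≥0∞) : Prop where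
  aemeasurable : AEMeasurable ν volume
  bijective : Function.Bijective (kernelW p ν)
  young : IsYoungFunction fun t => criticalFunction p ν (t ^ (1 / p))
  growth : ∃ θ : ℝ≥0, 0 < θ ∧ ∀ s t : ℝ≥0∞, 0 < t → t ≠ ∞ → s ≤ t →
    criticalFunction p ν (θ * (s / t)) ≤ criticalFunction p ν s / criticalFunction p ν t

/-- The fractional kernel `|h|^{-d-sp}`. -/
def fractionalKernel (d : ℕ) (s p : ℝ) (h : EuclideanSpace ℝ (Fin d)) : ℝ≥0∞ :=
  ‖h‖ₑ ^ (-((d : ℝ) + s * p))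

/-- The critical exponent `p^*_s`, given by `1 / p^*_s = 1 / p - s / d`. -/
def sobolevExponent (d : ℕ) (s p : ℝ) : ℝ :=
  1 / (1 / p - s / d)

end

/-! The core is a Sobolev inequality on the whole space. By the bathtub principle, deleting from
`ℝ^d` a set of measure at most `r` leaves kernel mass at least `ν^#(r)`, and `φ` is defined exactly
so that `t^p ν^#(1/φ(t)) = φ(t)`. Suppose `∫ φ(|v|/l) ≤ 1`. For fixed `x` put `t = |v(x)|/(2l)`.
Chebyshev bounds the measure of `{|v| > |v(x)|/2}` by `1/φ(t)`, and off this set `|v(x) - v(y)| ≥ l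
t`, so the inner energy integral at `x` is at least `l^p φ(t)`. Integration gives `l^p ∫ φ(|v|/(2l))
≤ |v|^p_{W^p_ν}` (`lintegral_criticalFunction_half_le`).

The assumption on the modular is removed for bounded `v` with support of finite measure by testing
the scales `2^n l`: at the first one with modular at most `1`, the growth condition on `φ` compares
with the preceding scale and bounds the energy from below (`exists_sobolev_of_bounded`). Truncation
and Fatou extend the result to `L^p`.

On `Ω`, an almost decreasing `ν` is bounded below on bounded punctured balls, so Jensen gives a
Poincaré inequality for `u - u_Ω`. Extending `u - u_Ω` to `ℝ^d` and applying the Sobolev inequality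
there finishes the general case; the Poincaré inequality absorbs the `L^p` part of the Sobolev norm.
For the fractional kernel, scaling makes `φ` a multiple of `t^q` with `q = p^*_s`. -/

/-! ### Rearrangement and the bathtub principle. -/

theorem volume_ball_mul_ballRadius_pow {d : ℕ} (hd : 1 ≤ d) (r : ℝ≥0∞) :
    volume (Metric.ball (0 : EuclideanSpace ℝ (Fin d)) 1) * ballRadius d r ^ d = r := by
  have h0 : volume (Metric.ball (0 : EuclideanSpace ℝ (Fin d)) 1) ≠ 0 :=
    (Metric.measure_ball_pos _ _ one_pos).ne'
  have h1 : volume (Metric.ball (0 : EuclideanSpace ℝ (Fin d)) 1) ≠ ∞ := measure_ball_lt_top.ne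
  have hd' : (d : ℝ) ≠ 0 := by positivity
  rw [ballRadius, ← ENNReal.rpow_natCast, ← ENNReal.rpow_mul, one_div_mul_cancel hd',
    ENNReal.rpow_one, ENNReal.mul_div_cancel h0 h1]

theorem symmRearrangement_ballRadius {d : ℕ} (hd : 1 ≤ d) (ν : EuclideanSpace ℝ (Fin d) → ℝ≥0∞)
    (r : ℝ≥0∞) :
    symmRearrangement ν (ballRadius d r) = sInf {s : ℝ≥0∞ | 0 < s ∧ volume {h | s < ν h} ≤ r} := by
  rw [symmRearrangement, volume_ball_mul_ballRadius_pow hd]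

theorem symmRearrangement_congr_ae {d : ℕ} {ν ν' : EuclideanSpace ℝ (Fin d) → ℝ≥0∞}
    (h : ν =ᵐ[volume] ν') : symmRearrangement ν = symmRearrangement ν' := by
  have key (s : ℝ≥0∞) : volume {h | s < ν h} = volume {h | s < ν' h} :=
    measure_congr (by
      filter_upwards [h] with x hx
      exact propext (by change s < ν x ↔ s < ν' x; rw [hx]))
  funext ρ
  simp only [symmRearrangement, key]

theorem kernelSharp_congr_ae {d : ℕ} {ν ν' : EuclideanSpace ℝ (Fin d) → ℝ≥0∞}
    (h : ν =ᵐ[volume] ν') : kernelSharp ν = kernelSharp ν' := by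
  funext r
  simp only [kernelSharp, symmRearrangement_congr_ae h]
  rw [lintegral_congr_ae (ae_restrict_of_ae h)]
  refine setLIntegral_congr ?_
  filter_upwards [h] with x hx
  exact propext (by
    change ν x < _ ↔ ν' x < _
    rw [hx])

/-- The closed superlevel set of `ν` at the level `ν^*(η(r))` has measure at least `r`. -/
theorem le_volume_superlevel {d : ℕ} (hd : 1 ≤ d) {ν : EuclideanSpace ℝ (Fin d) → ℝ≥0∞}
    (hν : Measurable ν) {r : ℝ≥0∞} (hr : kernelSharp ν r ≠ ∞)
    (hs : 0 < symmRearrangement ν (ballRadius d r)) :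
    r ≤ volume {h | symmRearrangement ν (ballRadius d r) ≤ ν h} := by
  unfold kernelSharp at hr
  generalize hS : symmRearrangement ν (ballRadius d r) = S at *
  rw [symmRearrangement_ballRadius hd] at hS
  by_contra! hlt
  obtain ⟨a, ha, haS, hat⟩ := exists_seq_strictMono_tendsto' hs
  have hgt (n) : r < volume {h | a n < ν h} := by
    by_contra! hle
    exact absurd (haS n).2 (not_lt.2 (hS ▸ sInf_le ⟨(haS n).1, hle⟩))
  -- Continuity from above needs one set of finite measure. Chebyshev controls `{a 0 ≤ ν < S}`
  -- because `ν^#(r)` is finite; the rest, `{S ≤ ν}`, has measure below `r` by contradiction.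
  have hfin : volume {h | a 0 < ν h} ≠ ∞ := by
    have h1 : volume.restrict {h | ν h < S} {h | a 0 ≤ ν h} ≠ ∞ :=
      ((meas_ge_le_lintegral_div hν.aemeasurable (haS 0).1.ne' (haS 0).2.ne_top).trans_lt
        (ENNReal.div_lt_top hr (haS 0).1.ne')).ne
    rw [Measure.restrict_apply (measurableSet_le measurable_const hν)] at h1
    refine ((measure_mono (t := {h | S ≤ ν h} ∪ ({h | a 0 ≤ ν h} ∩ {h | ν h < S})) ?_).trans_lt
      ((measure_union_le _ _).trans_lt (ENNReal.add_lt_top.2 ⟨hlt.trans_le le_top, h1.lt_top⟩))).ne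
    intro h hh
    rcases le_or_gt S (ν h) with h2 | h2
    · exact Or.inl h2
    · exact Or.inr ⟨(show a 0 < ν h from hh).le, h2⟩
  have hI : {h | S ≤ ν h} = ⋂ n, {h | a n < ν h} := by
    ext h
    simp only [mem_ofPred_eq, mem_iInter]
    exact ⟨fun hh n => (haS n).2.trans_le hh,
      fun hh => le_of_tendsto' hat fun n => (hh n).le⟩
  have ht := tendsto_measure_iInter_atTop (μ := volume) (s := fun n => {h | a n < ν h})
    (fun n => (measurableSet_lt measurable_const hν).nullMeasurableSet)
    (fun m n hmn h hh => lt_of_le_of_lt (ha.monotone hmn) hh) ⟨0, hfin⟩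
  rw [← hI] at ht
  exact absurd (ge_of_tendsto' ht fun n => (hgt n).le) (not_le.2 hlt)

/-- Bathtub principle: the cheapest set of measure `r` to keep out of the integral sits where `ν` is
largest. The part of `{ν < S}` lost to `A` is compensated by the part of `{ν ≥ S}` outside `A`,
which is at least as large in measure. -/
theorem kernelSharp_le_setLIntegral_compl {d : ℕ} (hd : 1 ≤ d)
    {ν : EuclideanSpace ℝ (Fin d) → ℝ≥0∞} (hν : Measurable ν) {r : ℝ≥0∞}
    (hr : kernelSharp ν r ≠ ∞) (hr' : r ≠ ∞) {A : Set (EuclideanSpace ℝ (Fin d))}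
    (hA : MeasurableSet A) (hAr : volume A ≤ r) :
    kernelSharp ν r ≤ ∫⁻ h in Aᶜ, ν h := by
  have hsup := le_volume_superlevel hd hν hr
  unfold kernelSharp at *
  generalize symmRearrangement ν (ballRadius d r) = S at *
  rcases eq_or_ne S 0 with rfl | hS
  · simp
  have hm : MeasurableSet {h | ν h < S} := measurableSet_lt hν measurable_const
  have hc : {h | S ≤ ν h} = {h | ν h < S}ᶜ := by ext; simp
  specialize hsup (pos_iff_ne_zero.2 hS)
  rw [hc] at hsup
  have hvol : volume (A ∩ {h | ν h < S}) ≤ volume ({h | ν h < S}ᶜ \ A) := by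
    have h1 := measure_inter_add_sdiff (μ := volume) A hm
    have h2 := measure_inter_add_sdiff (μ := volume) ({h | ν h < S}ᶜ) hA
    rw [sdiff_eq, inter_comm A (_)ᶜ] at h1
    have h3 : volume ({h | ν h < S}ᶜ ∩ A) ≠ ∞ :=
      ((measure_mono inter_subset_right).trans_lt (hAr.trans_lt hr'.lt_top)).ne
    rw [← ENNReal.add_le_add_iff_right h3, h1, add_comm, h2]
    exact hAr.trans hsup
  rw [← lintegral_inter_add_sdiff ν {h | ν h < S} hA,
    ← lintegral_inter_add_sdiff ν Aᶜ hm, add_comm]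
  have e1 : {h | ν h < S} \ A = Aᶜ ∩ {h | ν h < S} := by rw [sdiff_eq, inter_comm]
  have e2 : Aᶜ \ {h | ν h < S} = {h | ν h < S}ᶜ \ A := by rw [sdiff_eq, sdiff_eq, inter_comm]
  rw [e1, e2]
  refine add_le_add le_rfl ?_
  calc ∫⁻ h in {h | ν h < S} ∩ A, ν h
      ≤ ∫⁻ _ in {h | ν h < S} ∩ A, S :=
        setLIntegral_mono measurable_const fun h hh => le_of_lt hh.1
    _ = S * volume (A ∩ {h | ν h < S}) := by rw [setLIntegral_const, inter_comm]
    _ ≤ S * volume ({h | ν h < S}ᶜ \ A) := by gcongr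
    _ = ∫⁻ _ in {h | ν h < S}ᶜ \ A, S := by rw [setLIntegral_const]
    _ ≤ ∫⁻ h in {h | ν h < S}ᶜ \ A, ν h :=
        setLIntegral_mono hν fun h hh => not_lt.1 hh.1

theorem kernelSharp_le_setLIntegral_sub {d : ℕ} (hd : 1 ≤ d)
    {ν : EuclideanSpace ℝ (Fin d) → ℝ≥0∞} (hν : AEMeasurable ν volume) {r : ℝ≥0∞}
    (hr : kernelSharp ν r ≠ ∞) (hr' : r ≠ ∞) {A : Set (EuclideanSpace ℝ (Fin d))}
    (hA : MeasurableSet A) (hAr : volume A ≤ r) (x : EuclideanSpace ℝ (Fin d)) :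
    kernelSharp ν r ≤ ∫⁻ y in Aᶜ, ν (x - y) := by
  have hmp := Measure.measurePreserving_sub_left (volume : Measure (EuclideanSpace ℝ (Fin d))) x
  have hae : ∀ᵐ y, ν (x - y) = hν.mk ν (x - y) :=
    hmp.quasiMeasurePreserving.ae_eq_comp hν.ae_eq_mk
  rw [lintegral_congr_ae (ae_restrict_of_ae hae)]
  rw [kernelSharp_congr_ae hν.ae_eq_mk] at hr ⊢
  have hpre : (fun y => x - y) ⁻¹' ((fun y => x - y) ⁻¹' A)ᶜ = Aᶜ := by
    ext y; simp
  rw [← hpre, hmp.setLIntegral_comp_preimage (hmp.measurable hA).compl hν.measurable_mk]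
  exact kernelSharp_le_setLIntegral_compl hd hν.measurable_mk hr hr' (hmp.measurable hA)
    (by rwa [hmp.measure_preimage hA.nullMeasurableSet])

/-! ### The critical function `φ`: endpoint values, convexity, doubling. -/

section CriticalFunction

variable {d : ℕ} {p : ℝ} {ν : EuclideanSpace ℝ (Fin d) → ℝ≥0∞}

theorem kernelW_zero (hp : 1 ≤ p) : kernelW p ν 0 = 0 := by
  have : 0 < p := by positivity
  simp [kernelW, this]

theorem kernelW_top : kernelW p ν ∞ = ∞ := if_pos rfl

namespace CriticalKernel

theorem kernelW_invFun (h : CriticalKernel p ν) (t : ℝ≥0∞) :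
    kernelW p ν (Function.invFun (kernelW p ν) t) = t :=
  Function.rightInverse_invFun h.bijective.2 t

theorem criticalFunction_kernelW_inv (h : CriticalKernel p ν) (r : ℝ≥0∞) :
    criticalFunction p ν (kernelW p ν r)⁻¹ = r⁻¹ := by
  rw [criticalFunction, inv_inv, Function.leftInverse_invFun h.bijective.1]

theorem criticalFunction_zero (h : CriticalKernel p ν) : criticalFunction p ν 0 = 0 := by
  have := h.criticalFunction_kernelW_inv ∞
  rwa [kernelW_top, ENNReal.inv_top] at this

theorem criticalFunction_top (h : CriticalKernel p ν) (hp : 1 ≤ p) :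
    criticalFunction p ν ∞ = ∞ := by
  have := h.criticalFunction_kernelW_inv 0
  rwa [kernelW_zero hp, ENNReal.inv_zero] at this

theorem criticalFunction_injective (h : CriticalKernel p ν) :
    Function.Injective (criticalFunction p ν) := by
  intro s t hst
  have := congrArg (kernelW p ν) (inv_injective hst)
  rw [h.kernelW_invFun, h.kernelW_invFun] at this
  exact inv_injective this

theorem criticalFunction_ne_zero (h : CriticalKernel p ν) {t : ℝ≥0∞} (ht : t ≠ 0) :
    criticalFunction p ν t ≠ 0 :=
  fun h0 => ht (h.criticalFunction_injective (h0.trans h.criticalFunction_zero.symm))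

theorem criticalFunction_ne_top (h : CriticalKernel p ν) (hp : 1 ≤ p) {t : ℝ≥0∞} (ht : t ≠ ∞) :
    criticalFunction p ν t ≠ ∞ :=
  fun h0 => ht (h.criticalFunction_injective (h0.trans (h.criticalFunction_top hp).symm))

/-- An infinite value would give `w(r) = ∞ = w(∞)`, against injectivity of `w`. -/
theorem kernelSharp_ne_top (h : CriticalKernel p ν) (hp : 1 ≤ p) {r : ℝ≥0∞} (h0 : r ≠ 0)
    (h1 : r ≠ ∞) : kernelSharp ν r ≠ ∞ := by
  intro h2
  refine h1 (h.bijective.1 ?_)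
  have : 0 < 1 / p := by positivity
  rw [kernelW_top, kernelW, if_neg h1, h2, ENNReal.mul_top h0, ENNReal.top_rpow_of_pos this]

theorem kernelSharp_ne_zero (h : CriticalKernel p ν) (hp : 1 ≤ p) {r : ℝ≥0∞} (h0 : r ≠ 0)
    (h1 : r ≠ ∞) : kernelSharp ν r ≠ 0 := by
  intro h2
  refine h0 (h.bijective.1 ?_)
  have : 0 < 1 / p := by positivity
  rw [kernelW_zero hp, kernelW, if_neg h1, h2, mul_zero, ENNReal.zero_rpow_of_pos this]

/-- This is `w(1/φ(t)) = 1/t` raised to the power `p`; it turns kernel mass into values of `φ`. -/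
theorem rpow_mul_kernelSharp (h : CriticalKernel p ν) (hp : 1 ≤ p) {t : ℝ≥0∞} (h0 : t ≠ 0)
    (h1 : t ≠ ∞) :
    t ^ p * kernelSharp ν (criticalFunction p ν t)⁻¹ = criticalFunction p ν t := by
  have hp0 : p ≠ 0 := by positivity
  have hφ0 := h.criticalFunction_ne_zero h0
  have hφ1 := h.criticalFunction_ne_top hp h1
  have hw : kernelW p ν (criticalFunction p ν t)⁻¹ = t⁻¹ := by
    rw [criticalFunction, inv_inv, h.kernelW_invFun]
  rw [kernelW, if_neg (ENNReal.inv_ne_top.2 hφ0)] at hw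
  have hw' := congrArg (fun a : ℝ≥0∞ => a ^ p) hw
  simp only [← ENNReal.rpow_mul, one_div_mul_cancel hp0, ENNReal.rpow_one] at hw'
  rw [ENNReal.inv_rpow] at hw'
  have ht0 : t ^ p ≠ 0 := by simp [h0, h1]
  have ht1 : t ^ p ≠ ∞ := by simp [h0, h1]
  calc t ^ p * kernelSharp ν (criticalFunction p ν t)⁻¹
      = t ^ p * (criticalFunction p ν t *
          ((criticalFunction p ν t)⁻¹ * kernelSharp ν (criticalFunction p ν t)⁻¹)) := by
        rw [← mul_assoc (criticalFunction p ν t), ENNReal.mul_inv_cancel hφ0 hφ1, one_mul]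
    _ = criticalFunction p ν t * (t ^ p * (t ^ p)⁻¹) := by rw [hw']; ring
    _ = criticalFunction p ν t := by rw [ENNReal.mul_inv_cancel ht0 ht1, mul_one]

/-- Convexity of `t ↦ φ(t^{1/p})` on the segment from `0`. -/
theorem criticalFunction_mul_le (h : CriticalKernel p ν) (hp : 1 ≤ p) {a : ℝ≥0} (ha : a ≤ 1)
    (t : ℝ≥0∞) :
    criticalFunction p ν (a ^ (1 / p) * t) ≤ a * criticalFunction p ν t := by
  have hp0 : p ≠ 0 := by positivity
  have := h.young.2.2 (mem_univ (0 : ℝ≥0∞)) (mem_univ (t ^ p)) (zero_le (a := 1 - a))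
    (zero_le (a := a)) (tsub_add_cancel_of_le ha)
  have hy := h.young.1
  simp only [smul_zero, zero_add, hy, ENNReal.smul_def, smul_eq_mul] at this
  rwa [ENNReal.mul_rpow_of_nonneg _ _ (by positivity), ← ENNReal.rpow_mul, mul_one_div_cancel hp0,
    ENNReal.rpow_one] at this

theorem criticalFunction_monotone (h : CriticalKernel p ν) (hp : 1 ≤ p) :
    Monotone (criticalFunction p ν) := by
  intro s t hst
  have hp0 : p ≠ 0 := by positivity
  rcases eq_or_ne t ∞ with rfl | ht
  · rw [h.criticalFunction_top hp]; exact le_top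
  rcases eq_or_ne t 0 with rfl | ht0
  · rw [nonpos_iff_eq_zero.1 hst]
  lift t to ℝ≥0 using ht
  lift s to ℝ≥0 using (ne_top_of_le_ne_top ENNReal.coe_ne_top hst)
  norm_cast at hst ht0
  have ha : (s / t) ^ p ≤ 1 :=
    NNReal.rpow_le_one (div_le_one_of_le₀ hst (zero_le)) (by positivity)
  have := h.criticalFunction_mul_le hp ha t
  rw [← ENNReal.coe_rpow_of_nonneg _ (by positivity), ← NNReal.rpow_mul, mul_one_div_cancel hp0,
    NNReal.rpow_one, ← ENNReal.coe_mul, div_mul_cancel₀ _ ht0] at this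
  exact this.trans (mul_le_of_le_one_left (zero_le) (by exact_mod_cast ha))

/-- The doubling property of `φ`, in the form `c φ(t) ≤ φ(t / 4)`. -/
theorem exists_mul_criticalFunction_le (h : CriticalKernel p ν) (hp : 1 ≤ p) :
    ∃ c : ℝ≥0, 0 < c ∧ ∀ t, c * criticalFunction p ν t ≤ criticalFunction p ν (t / 4) := by
  obtain ⟨θ, hθ, H⟩ := h.growth
  have hθ4 : criticalFunction p ν (θ * 4⁻¹) ≠ ∞ :=
    h.criticalFunction_ne_top hp (ENNReal.mul_ne_top (by simp) (by simp))
  have hθ0 : criticalFunction p ν (θ * 4⁻¹) ≠ 0 :=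
    h.criticalFunction_ne_zero (by simp [hθ.ne'])
  -- The constant is `φ(θ/4)`, from the growth condition with `s = t/4`.
  refine ⟨(criticalFunction p ν (θ * 4⁻¹)).toNNReal, ENNReal.toNNReal_pos hθ0 hθ4, fun t => ?_⟩
  rw [ENNReal.coe_toNNReal hθ4]
  rcases eq_or_ne t 0 with rfl | h0
  · simp [h.criticalFunction_zero]
  rcases eq_or_ne t ∞ with rfl | h1
  · rw [ENNReal.top_div_of_ne_top (by simp), h.criticalFunction_top hp]; exact le_top
  have hle : t / 4 ≤ t := by
    rw [div_eq_mul_inv]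
    exact mul_le_of_le_one_right (zero_le) (by simp [ENNReal.inv_le_one])
  have := H (t / 4) t (pos_iff_ne_zero.2 h0) h1 hle
  have e : t / 4 / t = 4⁻¹ := by
    rw [div_eq_mul_inv, div_eq_mul_inv, mul_right_comm, ENNReal.mul_inv_cancel h0 h1, one_mul]
  rw [e] at this
  exact (ENNReal.le_div_iff_mul_le (Or.inl (h.criticalFunction_ne_zero h0))
    (Or.inl (h.criticalFunction_ne_top hp h1))).1 this

end CriticalKernel

end CriticalFunction

/-! ### The Sobolev inequality for bounded functions with support of finite measure. -/

theorem nonlocalEnergy_univ_congr_ae {d : ℕ} {p : ℝ} {ν : EuclideanSpace ℝ (Fin d) → ℝ≥0∞}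
    {u v : EuclideanSpace ℝ (Fin d) → ℝ} (h : u =ᵐ[volume] v) :
    nonlocalEnergy p ν univ u = nonlocalEnergy p ν univ v := by
  simp only [nonlocalEnergy, Measure.restrict_univ]
  refine lintegral_congr_ae ?_
  filter_upwards [h] with x hx
  refine lintegral_congr_ae ?_
  filter_upwards [h] with y hy
  rw [hx, hy]

theorem nonlocalEnergy_mono {d : ℕ} {p : ℝ} (hp : 1 ≤ p)
    {ν : EuclideanSpace ℝ (Fin d) → ℝ≥0∞} {Ω : Set (EuclideanSpace ℝ (Fin d))}
    {u v : EuclideanSpace ℝ (Fin d) → ℝ} (h : ∀ x y, |u x - u y| ≤ |v x - v y|) :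
    nonlocalEnergy p ν Ω u ≤ nonlocalEnergy p ν Ω v := by
  refine lintegral_mono fun x => lintegral_mono fun y => ?_
  have : ‖u x - u y‖ₑ ≤ ‖v x - v y‖ₑ := enorm_le_iff_norm_le.2 (h x y)
  gcongr

namespace CriticalKernel

variable {d : ℕ} {p : ℝ} {ν : EuclideanSpace ℝ (Fin d) → ℝ≥0∞}

/-- The estimate is pointwise in `x`: only those `y` with `|v(y)| ≤ |v(x)|/2` are kept in the inner
integral, and the modular bound makes the discarded set small enough for the bathtub principle. -/
theorem lintegral_criticalFunction_half_le (hd : 1 ≤ d) (hp : 1 ≤ p) (h : CriticalKernel p ν)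
    {v : EuclideanSpace ℝ (Fin d) → ℝ} (hv : Measurable v) {l : ℝ≥0} (hl : 0 < l)
    (hle : ∫⁻ x, criticalFunction p ν (‖v x‖ₑ / l) ≤ 1) :
    l ^ p * ∫⁻ x, criticalFunction p ν (‖v x‖ₑ / (2 * l)) ≤ nonlocalEnergy p ν univ v := by
  have hl0 : (l : ℝ≥0∞) ≠ 0 := by simpa using hl.ne'
  have hlp : (l : ℝ≥0∞) ^ p ≠ ∞ := by simp [hl.ne']
  simp only [nonlocalEnergy, Measure.restrict_univ]
  rw [← lintegral_const_mul' _ _ hlp]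
  refine lintegral_mono fun x => ?_
  rcases eq_or_ne (v x) 0 with h0 | h0
  · simp [h0, h.criticalFunction_zero]
  set t : ℝ≥0∞ := ‖v x‖ₑ / (2 * l) with ht
  have hlt : l * t = ‖v x‖ₑ / 2 := by
    rw [ht, div_eq_mul_inv, div_eq_mul_inv, ENNReal.mul_inv (by simp) (by simp)]
    calc l * (‖v x‖ₑ * (2⁻¹ * (l : ℝ≥0∞)⁻¹)) = l * (l : ℝ≥0∞)⁻¹ * (‖v x‖ₑ * 2⁻¹) := by ring
      _ = _ := by rw [ENNReal.mul_inv_cancel hl0 (by simp), one_mul]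
  have ht0 : t ≠ 0 := by
    refine (ENNReal.div_pos (by simpa using h0) (ENNReal.mul_ne_top (by simp) (by simp))).ne'
  have ht1 : t ≠ ∞ := (ENNReal.div_lt_top (by simp) (by simp [hl0])).ne
  have hφ0 := h.criticalFunction_ne_zero ht0
  have hφ1 := h.criticalFunction_ne_top hp ht1
  have hA : MeasurableSet {y | ‖v x‖ₑ / 2 < ‖v y‖ₑ} :=
    measurableSet_lt measurable_const hv.enorm
  -- Chebyshev for `φ(|v|/l)` at height `φ(t)`, since `|v(y)| > |v(x)|/2 = l t` forces `φ(|v(y)|/l)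
  -- ≥ φ(t)`.
  have hvol : volume {y | ‖v x‖ₑ / 2 < ‖v y‖ₑ} ≤ (criticalFunction p ν t)⁻¹ := by
    have hmeas : Measurable fun y => criticalFunction p ν (‖v y‖ₑ / l) :=
      (h.criticalFunction_monotone hp).measurable.comp (hv.enorm.div_const _)
    rw [← one_div]
    refine le_trans (measure_mono fun y hy => ?_)
      ((meas_ge_le_lintegral_div hmeas.aemeasurable hφ0 hφ1).trans (by gcongr))
    refine h.criticalFunction_monotone hp ?_
    rw [ENNReal.le_div_iff_mul_le (Or.inl hl0) (Or.inl (by simp)), mul_comm, hlt]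
    exact le_of_lt hy
  calc (l : ℝ≥0∞) ^ p * criticalFunction p ν t
      = (‖v x‖ₑ / 2) ^ p * kernelSharp ν (criticalFunction p ν t)⁻¹ := by
        rw [← hlt, ENNReal.mul_rpow_of_nonneg _ _ (by positivity), mul_assoc,
          h.rpow_mul_kernelSharp hp ht0 ht1]
    _ ≤ (‖v x‖ₑ / 2) ^ p * ∫⁻ y in {y | ‖v x‖ₑ / 2 < ‖v y‖ₑ}ᶜ, ν (x - y) := by
        gcongr
        exact kernelSharp_le_setLIntegral_sub hd h.aemeasurable
          (h.kernelSharp_ne_top hp (ENNReal.inv_ne_zero.2 hφ1) (ENNReal.inv_ne_top.2 hφ0))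
          (ENNReal.inv_ne_top.2 hφ0) hA hvol x
    _ = ∫⁻ y in {y | ‖v x‖ₑ / 2 < ‖v y‖ₑ}ᶜ, (‖v x‖ₑ / 2) ^ p * ν (x - y) := by
        refine (lintegral_const_mul' _ _ ?_).symm
        exact ENNReal.rpow_ne_top_of_nonneg (by positivity) (ENNReal.div_lt_top (by simp) (by simp)).ne
    _ ≤ ∫⁻ y in {y | ‖v x‖ₑ / 2 < ‖v y‖ₑ}ᶜ, ‖v x - v y‖ₑ ^ p * ν (x - y) := by
        refine setLIntegral_mono' hA.compl fun y hy => ?_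
        have hy' : ‖v y‖ₑ ≤ ‖v x‖ₑ / 2 := not_lt.1 hy
        have h1 : ‖v x‖ₑ / 2 ≤ ‖v x - v y‖ₑ := by
          rw [← ENNReal.add_le_add_iff_right (a := ‖v x‖ₑ / 2)
            (ENNReal.div_lt_top (by simp) (by simp)).ne, ENNReal.add_halves]
          calc ‖v x‖ₑ = ‖(v x - v y) + v y‖ₑ := by rw [sub_add_cancel]
            _ ≤ ‖v x - v y‖ₑ + ‖v y‖ₑ := enorm_add_le _ _
            _ ≤ _ := by gcongr
        gcongr
    _ ≤ ∫⁻ y, ‖v x - v y‖ₑ ^ p * ν (x - y) := setLIntegral_le_lintegral _ _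

/-- The modular of a bounded function supported on a set of finite measure is eventually small. -/
theorem exists_lintegral_criticalFunction_le_one (hp : 1 ≤ p) (h : CriticalKernel p ν)
    {v : EuclideanSpace ℝ (Fin d) → ℝ} (hv : Measurable v) {B : ℝ≥0} (hB : ∀ x, ‖v x‖ₑ ≤ B)
    (hs : volume {x | v x ≠ 0} ≠ ∞) {l : ℝ≥0} (hl : 0 < l) :
    ∃ n : ℕ, ∫⁻ x, criticalFunction p ν (‖v x‖ₑ / (2 ^ n * l)) ≤ 1 := by
  have hp0 : p ≠ 0 := by positivity
  set M := criticalFunction p ν (B / l) * volume {x | v x ≠ 0} with hM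
  have hMt : M ≠ ∞ := ENNReal.mul_ne_top (h.criticalFunction_ne_top hp
    (ENNReal.div_lt_top (by simp) (by simpa using hl.ne')).ne) hs
  have hms : MeasurableSet {x | v x ≠ 0} := (measurableSet_eq_fun hv measurable_const).compl
  obtain ⟨n, hn⟩ : ∃ n : ℕ, M * (2⁻¹) ^ n ≤ 1 := by
    have := ENNReal.Tendsto.const_mul (a := M) (ENNReal.tendsto_pow_atTop_nhds_zero_of_lt_one
      (r := (2 : ℝ≥0∞)⁻¹) (by simp)) (Or.inr hMt)
    rw [mul_zero] at this
    exact (this.eventually_le_const one_pos).exists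
  refine ⟨n, ?_⟩
  have key (x) : criticalFunction p ν (‖v x‖ₑ / (2 ^ n * l)) ≤
      {x | v x ≠ 0}.indicator (fun _ => (2⁻¹) ^ n * criticalFunction p ν (B / l)) x := by
    by_cases h0 : v x = 0
    · simp [h0, h.criticalFunction_zero]
    rw [indicator_of_mem (by exact h0)]
    have ha : ((2 : ℝ≥0)⁻¹) ^ n ≤ 1 := pow_le_one₀ (by positivity) (by norm_num [inv_le_one_iff₀])
    have h1 := h.criticalFunction_mul_le hp ha (B / l)
    push_cast [ENNReal.coe_inv] at h1
    refine le_trans (h.criticalFunction_monotone hp ?_) h1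
    -- Convexity of `φ(t^{1/p})` gains the factor `2^{-n}` after scaling by `2^{-n/p}`, a weaker
    -- scaling than `2^{-n}` because `p ≥ 1`.
    have h2 : ((2 : ℝ≥0∞)⁻¹) ^ n ≤ ((2⁻¹) ^ n) ^ (1 / p) := by
      conv_lhs => rw [← ENNReal.rpow_one ((2⁻¹ : ℝ≥0∞) ^ n)]
      refine ENNReal.rpow_le_rpow_of_exponent_ge (pow_le_one' (by simp) n) ?_
      rw [div_le_one (by positivity)]; exact hp
    calc ‖v x‖ₑ / (2 ^ n * l) = (2⁻¹) ^ n * (‖v x‖ₑ / l) := by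
          rw [div_eq_mul_inv, div_eq_mul_inv, ENNReal.mul_inv (by simp) (by simp),
            ENNReal.inv_pow]
          ring
      _ ≤ _ := by gcongr; exact hB x
  calc _ ≤ _ := lintegral_mono key
    _ = M * (2⁻¹) ^ n := by
      rw [lintegral_indicator hms, setLIntegral_const, hM]; ring
    _ ≤ 1 := hn

/-- The Sobolev inequality for bounded functions supported on a set of finite measure. -/
theorem exists_sobolev_of_bounded (hd : 1 ≤ d) (hp : 1 ≤ p) (h : CriticalKernel p ν) :
    ∃ c : ℝ≥0, 0 < c ∧ ∀ v : EuclideanSpace ℝ (Fin d) → ℝ, Measurable v →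
      (∃ B : ℝ≥0, ∀ x, ‖v x‖ₑ ≤ B) → volume {x | v x ≠ 0} ≠ ∞ → ∀ l : ℝ≥0, 0 < l →
      nonlocalEnergy p ν univ v ≤ c * l ^ p →
      ∫⁻ x, criticalFunction p ν (‖v x‖ₑ / l) ≤ 1 := by
  obtain ⟨c, hc, H⟩ := h.exists_mul_criticalFunction_le hp
  refine ⟨c, hc, fun v hv ⟨B, hB⟩ hs l hl hE => ?_⟩
  have hex := h.exists_lintegral_criticalFunction_le_one hp hv hB hs hl
  by_contra! hgt
  classical
  -- The first good scale is not `l` itself, so the preceding scale `2^n l` exists and has modular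
  -- above `1`.
  obtain ⟨n, hn⟩ : ∃ n, Nat.find hex = n + 1 := by
    refine Nat.exists_eq_succ_of_ne_zero fun h0 => ?_
    have := Nat.find_spec hex
    rw [h0, pow_zero, one_mul] at this
    exact absurd this (not_le.2 hgt)
  have h1 := Nat.find_spec hex
  have h2 := Nat.find_min hex (m := n) (by omega)
  rw [hn] at h1
  rw [not_le] at h2
  have h3 := h.lintegral_criticalFunction_half_le hd hp hv (l := 2 ^ (n + 1) * l) (by positivity)
    (by simpa using h1)
  -- The factor `4` is one dyadic step times the factor `2` in the half-scale estimate `h3`.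
  have h4 : c * ∫⁻ x, criticalFunction p ν (‖v x‖ₑ / (2 ^ n * l)) ≤
      ∫⁻ x, criticalFunction p ν (‖v x‖ₑ / (2 * ↑(2 ^ (n + 1) * l : ℝ≥0))) := by
    rw [← lintegral_const_mul' _ _ (by simp)]
    refine lintegral_mono fun x => (H _).trans (h.criticalFunction_monotone hp (le_of_eq ?_))
    have e : (2 * ↑(2 ^ (n + 1) * l : ℝ≥0) : ℝ≥0∞) = (2 ^ n * l) * 4 := by
      push_cast; ring
    rw [e, div_eq_mul_inv, div_eq_mul_inv, div_eq_mul_inv, mul_assoc,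
      ENNReal.mul_inv (by simp) (by simp) (a := 2 ^ n * (l : ℝ≥0∞))]
  have hlp0 : (l : ℝ≥0∞) ^ p ≠ 0 := by simp [hl.ne']
  have hlp : (l : ℝ≥0∞) ^ p ≠ ∞ := by simp [hl.ne']
  have h5 : (l : ℝ≥0∞) ^ p ≤ (↑(2 ^ (n + 1) * l : ℝ≥0) : ℝ≥0∞) ^ p := by
    have : l ≤ 2 ^ (n + 1) * l := le_mul_of_one_le_left zero_le (one_le_pow₀ (by norm_num))
    gcongr
  refine lt_irrefl ((c : ℝ≥0∞) * l ^ p) ?_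
  calc (c : ℝ≥0∞) * l ^ p
      < c * l ^ p * ∫⁻ x, criticalFunction p ν (‖v x‖ₑ / (2 ^ n * l)) := by
        conv_lhs => rw [← mul_one ((c : ℝ≥0∞) * l ^ p)]
        exact (ENNReal.mul_lt_mul_iff_right (by simp [hc.ne', hlp0])
          (ENNReal.mul_ne_top (by simp) hlp)).2 h2
    _ = l ^ p * (c * ∫⁻ x, criticalFunction p ν (‖v x‖ₑ / (2 ^ n * l))) := by ring
    _ ≤ _ := mul_le_mul' h5 h4
    _ ≤ _ := h3.trans hE

end CriticalKernel

/-! ### Truncation and the Sobolev inequality on `L^p`. -/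

/-- The truncation `min ((|t| - 1 / (n + 1))₊) n` of `|t|`. -/
noncomputable def absTruncation (n : ℕ) (t : ℝ) : ℝ := min (max (|t| - 1 / (n + 1)) 0) n

theorem absTruncation_nonneg (n : ℕ) (t : ℝ) : 0 ≤ absTruncation n t :=
  le_min (le_max_right _ _) (Nat.cast_nonneg n)

theorem abs_absTruncation_sub_le (n : ℕ) (s t : ℝ) :
    |absTruncation n s - absTruncation n t| ≤ |s - t| := by
  refine (abs_min_sub_min_le_max _ _ _ _).trans ?_
  rw [sub_self, abs_zero, max_eq_left (abs_nonneg _)]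
  refine (abs_max_sub_max_le_abs _ _ _).trans ?_
  rw [sub_sub_sub_cancel_right]
  exact abs_abs_sub_abs_le s t

theorem measurable_absTruncation (n : ℕ) : Measurable (absTruncation n) := by
  unfold absTruncation; fun_prop

theorem one_div_le_of_absTruncation_ne_zero {n : ℕ} {t : ℝ} (h : absTruncation n t ≠ 0) :
    1 / ((n : ℝ) + 1) ≤ |t| := by
  by_contra! hlt
  refine h ?_
  rw [absTruncation, max_eq_right (by linarith), min_eq_left (Nat.cast_nonneg n)]

theorem eventually_half_le_absTruncation (t : ℝ) :
    ∀ᶠ n in Filter.atTop, |t| / 2 ≤ absTruncation n t := by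
  rcases eq_or_ne t 0 with rfl | ht
  · simp [absTruncation_nonneg]
  have h0 : 0 < |t| / 2 := by positivity
  filter_upwards [tendsto_one_div_add_atTop_nhds_zero_nat.eventually_le_const h0,
    tendsto_natCast_atTop_atTop.eventually_ge_atTop (|t| / 2)] with n h1 h2
  exact le_min ((by linarith : |t| / 2 ≤ |t| - 1 / (n + 1)).trans (le_max_left _ _)) h2

namespace CriticalKernel

variable {d : ℕ} {p : ℝ} {ν : EuclideanSpace ℝ (Fin d) → ℝ≥0∞}

/-- Truncations are `1`-Lipschitz, so they do not increase the energy, and they are bounded with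
support of finite measure when `u ∈ L^p`. They eventually exceed `|u|/2` pointwise, which costs the
factor `2`; Fatou passes to the limit without continuity of `φ`. -/
theorem exists_modular_le_one (hd : 1 ≤ d) (hp : 1 ≤ p) (h : CriticalKernel p ν) :
    ∃ c : ℝ≥0, 0 < c ∧ ∀ u : EuclideanSpace ℝ (Fin d) → ℝ, MemLp u (ENNReal.ofReal p) volume →
      ∀ l : ℝ≥0, 0 < l → nonlocalEnergy p ν univ u ≤ c * l ^ p →
      ∫⁻ x, criticalFunction p ν (‖u x‖ₑ / (2 * l)) ≤ 1 := by
  obtain ⟨c, hc, H⟩ := h.exists_sobolev_of_bounded hd hp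
  refine ⟨c, hc, fun u hu l hl hE => ?_⟩
  wlog hum : Measurable u generalizing u
  · have hae := hu.1.ae_eq_mk
    have := this (hu.1.mk u) (hu.ae_eq hae) (by rwa [← nonlocalEnergy_univ_congr_ae hae])
      hu.1.stronglyMeasurable_mk.measurable
    refine le_of_eq_of_le (lintegral_congr_ae ?_) this
    filter_upwards [hae] with x hx
    rw [hx]
  have hmono := h.criticalFunction_monotone hp
  have hvm (n : ℕ) : Measurable fun x => absTruncation n (u x) :=
    (measurable_absTruncation n).comp hum
  have hv (n : ℕ) : ∫⁻ x, criticalFunction p ν (‖absTruncation n (u x)‖ₑ / l) ≤ 1 := by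
    refine H (fun x => absTruncation n (u x)) (hvm n) ⟨n, fun x => ?_⟩ ?_ l hl ?_
    · rw [Real.enorm_of_nonneg (absTruncation_nonneg _ _)]
      refine (ENNReal.ofReal_le_ofReal (min_le_right _ _)).trans ?_
      simp
    · have hp0 : ENNReal.ofReal p ≠ 0 := by simp; linarith
      have hε : ENNReal.ofReal (1 / ((n : ℝ) + 1)) ≠ 0 := by
        rw [Ne, ENNReal.ofReal_eq_zero, not_le]; positivity
      refine ((measure_mono fun x hx => ?_).trans_lt
        (hu.meas_ge_lt_top'_enorm hp0 ENNReal.ofReal_ne_top hε (by simp))).ne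
      change ENNReal.ofReal _ ≤ ‖u x‖ₑ
      rw [← ofReal_norm, Real.norm_eq_abs]
      exact ENNReal.ofReal_le_ofReal (one_div_le_of_absTruncation_ne_zero hx)
    · exact (nonlocalEnergy_mono hp fun x y => abs_absTruncation_sub_le n _ _).trans hE
  calc ∫⁻ x, criticalFunction p ν (‖u x‖ₑ / (2 * l))
      ≤ ∫⁻ x, Filter.liminf
          (fun n => criticalFunction p ν (‖absTruncation n (u x)‖ₑ / l)) Filter.atTop := by
        refine lintegral_mono fun x => Filter.le_liminf_of_le (by isBoundedDefault) ?_
        filter_upwards [eventually_half_le_absTruncation (u x)] with n hn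
        refine hmono ?_
        have h1 : ‖u x‖ₑ / 2 ≤ ‖absTruncation n (u x)‖ₑ := by
          rw [Real.enorm_of_nonneg (absTruncation_nonneg _ _), ← ofReal_norm,
            Real.norm_eq_abs]
          refine le_of_eq_of_le ?_ (ENNReal.ofReal_le_ofReal hn)
          rw [ENNReal.ofReal_div_of_pos two_pos]; simp
        rw [div_eq_mul_inv, ENNReal.mul_inv (by simp) (by simp), ← mul_assoc]
        exact mul_le_mul' h1 le_rfl
    _ ≤ Filter.liminf (fun n : ℕ =>
          ∫⁻ x, criticalFunction p ν (‖absTruncation n (u x)‖ₑ / l)) Filter.atTop :=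
        lintegral_liminf_le fun n => hmono.measurable.comp ((hvm n).enorm.div_const _)
    _ ≤ 1 := Filter.liminf_le_of_frequently_le' (Filter.Frequently.of_forall hv)

/-- The nonlocal Sobolev inequality on `ℝ^d`. -/
theorem exists_luxemburgNorm_le (hd : 1 ≤ d) (hp : 1 ≤ p) (h : CriticalKernel p ν) :
    ∃ K : ℝ≥0, 0 < K ∧ ∀ u : EuclideanSpace ℝ (Fin d) → ℝ, MemLp u (ENNReal.ofReal p) volume →
      luxemburgNorm (criticalFunction p ν) univ u ≤ K * nonlocalSeminorm p ν univ u := by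
  obtain ⟨c, hc, H⟩ := h.exists_modular_le_one hd hp
  have hp0 : 0 < p := by positivity
  have hcp : 0 < c ^ (1 / p) := NNReal.rpow_pos hc
  -- Solving `E ≤ c l^p` for the scale gives `c^{-1/p}`; the `2` is the loss from truncation.
  refine ⟨2 * (c ^ (1 / p))⁻¹, by positivity, fun u hu => ?_⟩
  refine le_of_forall_gt_imp_ge_of_dense fun b hb => ?_
  rcases eq_or_ne b ∞ with rfl | hbt
  · exact le_top
  lift b to ℝ≥0 using hbt
  have hb0 : 0 < b := by
    have := (zero_le (a := _)).trans_lt hb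
    exact_mod_cast this
  have hb2 : 2 * (b / 2) = b := by field_simp
  refine iInf₂_le b ⟨hb0, ?_⟩
  have hE : nonlocalEnergy p ν univ u ≤ c * (↑(b / 2 : ℝ≥0) : ℝ≥0∞) ^ p := by
    have h1 : nonlocalSeminorm p ν univ u ≤ c ^ (1 / p) * (↑(b / 2 : ℝ≥0) : ℝ≥0∞) := by
      rw [← hb2] at hb
      push_cast [ENNReal.coe_inv hcp.ne', ENNReal.coe_rpow_of_ne_zero hc.ne'] at hb
      have hb' : ((c : ℝ≥0∞) ^ (1 / p))⁻¹ * nonlocalSeminorm p ν univ u ≤ ↑(b / 2 : ℝ≥0) := by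
        rw [mul_assoc] at hb
        push_cast
        exact ((ENNReal.mul_lt_mul_iff_right (by simp) (by simp)).1 hb).le
      have hc0 : (c : ℝ≥0∞) ^ (1 / p) ≠ 0 := by simp [hc.ne']
      have hc1 : (c : ℝ≥0∞) ^ (1 / p) ≠ ∞ := by simp [hc.ne']
      calc _ = (c : ℝ≥0∞) ^ (1 / p) * (((c : ℝ≥0∞) ^ (1 / p))⁻¹ *
            nonlocalSeminorm p ν univ u) := by
            rw [← mul_assoc, ENNReal.mul_inv_cancel hc0 hc1, one_mul]
        _ ≤ _ := by gcongr
    have h2 := ENNReal.rpow_le_rpow h1 hp0.le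
    rwa [nonlocalSeminorm, ENNReal.mul_rpow_of_nonneg _ _ hp0.le, ← ENNReal.rpow_mul,
      ← ENNReal.rpow_mul, one_div_mul_cancel hp0.ne', ENNReal.rpow_one, ENNReal.rpow_one] at h2
  have := H u hu (b / 2) (by positivity) hE
  rw [Measure.restrict_univ]
  rw [← hb2]
  push_cast at this ⊢
  exact this

/-- The Orlicz space `L^φ(Ω)` is contained in `L^p(Ω)` when `Ω` has finite measure. -/
theorem memLp_of_memOrlicz (hp : 1 ≤ p) (h : CriticalKernel p ν)
    {Ω : Set (EuclideanSpace ℝ (Fin d))} (hΩ : volume Ω ≠ ∞) {u : EuclideanSpace ℝ (Fin d) → ℝ}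
    (hu : MemOrlicz (criticalFunction p ν) Ω u) :
    MemLp u (ENNReal.ofReal p) (volume.restrict Ω) := by
  obtain ⟨hum, l, hl, hφ⟩ := hu
  have hp0 : 0 < p := by positivity
  have hl0 : (l : ℝ≥0∞) ≠ 0 := by simpa using hl.ne'
  have h10 := h.criticalFunction_ne_zero one_ne_zero
  have h1t := h.criticalFunction_ne_top hp ENNReal.one_ne_top
  -- For `τ ≥ 1`, convexity with weight `τ^{-p}` gives `φ(1) ≤ τ^{-p} φ(τ)`, so `φ` grows at least
  -- like `τ^p`.
  have key (τ : ℝ≥0∞) (hτ : τ ≠ ∞) :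
      τ ^ p ≤ 1 + (criticalFunction p ν 1)⁻¹ * criticalFunction p ν τ := by
    rcases le_total τ 1 with h1 | h1
    · exact (ENNReal.rpow_le_one h1 hp0.le).trans le_self_add
    · refine le_trans ?_ le_add_self
      lift τ to ℝ≥0 using hτ
      have h1' : 1 ≤ τ := by exact_mod_cast h1
      have hτ0 : τ ≠ 0 := by positivity
      have ha : (τ⁻¹) ^ p ≤ 1 := NNReal.rpow_le_one (inv_le_one_of_one_le₀ h1') hp0.le
      have := h.criticalFunction_mul_le hp ha τ
      rw [← ENNReal.coe_rpow_of_nonneg _ (by positivity), ← NNReal.rpow_mul,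
        mul_one_div_cancel hp0.ne', NNReal.rpow_one, ← ENNReal.coe_mul, inv_mul_cancel₀ hτ0,
        NNReal.inv_rpow, ENNReal.coe_inv (by simp [hτ0]), ENNReal.coe_one,
        ENNReal.coe_rpow_of_nonneg _ hp0.le] at this
      calc (τ : ℝ≥0∞) ^ p = (criticalFunction p ν 1)⁻¹ * (τ ^ p * criticalFunction p ν 1) := by
            rw [mul_left_comm, ENNReal.inv_mul_cancel h10 h1t, mul_one]
        _ ≤ (criticalFunction p ν 1)⁻¹ *
              (τ ^ p * (((τ : ℝ≥0∞) ^ p)⁻¹ * criticalFunction p ν τ)) := by gcongr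
        _ = _ := by
            rw [← mul_assoc (_ ^ p), ENNReal.mul_inv_cancel (by simp [hτ0]) (by simp [hτ0]),
              one_mul]
  refine ⟨hum, ?_⟩
  rw [eLpNorm_lt_top_iff_lintegral_rpow_enorm_lt_top (by simpa using hp0) ENNReal.ofReal_ne_top,
    ENNReal.toReal_ofReal hp0.le]
  have hpt (x) : ‖u x‖ₑ ^ p ≤ l ^ p * (1 + (criticalFunction p ν 1)⁻¹ *
      criticalFunction p ν (‖u x‖ₑ / l)) := by
    calc ‖u x‖ₑ ^ p = (l * (‖u x‖ₑ / l)) ^ p := by rw [ENNReal.mul_div_cancel hl0 (by simp)]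
      _ = l ^ p * (‖u x‖ₑ / l) ^ p := ENNReal.mul_rpow_of_nonneg _ _ hp0.le
      _ ≤ _ := by
        gcongr
        exact key _ (ENNReal.div_lt_top (by simp) hl0).ne
  refine (lintegral_mono hpt).trans_lt ?_
  rw [lintegral_const_mul' _ _ (by simp [hl.ne']), lintegral_add_left measurable_const,
    lintegral_const_mul' _ _ (ENNReal.inv_ne_top.2 h10)]
  refine ENNReal.mul_lt_top (lt_top_iff_ne_top.2 (by simp [hl.ne'])) (ENNReal.add_lt_top.2 ⟨?_, ?_⟩)
  · simpa using hΩ.lt_top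
  · exact ENNReal.mul_lt_top (ENNReal.inv_lt_top.2 (pos_iff_ne_zero.2 h10)) hφ

/-! ### Lower bound for the kernel, and Jensen's inequality. -/

theorem exists_le_of_norm_le (hd : 1 ≤ d) (hp : 1 ≤ p) (h : CriticalKernel p ν)
    (hν : AlmostDecreasing ν) (R : ℝ) : ∃ c : ℝ≥0, 0 < c ∧ ∀ y, y ≠ 0 → ‖y‖ ≤ R → c ≤ ν y := by
  obtain ⟨κ, hκ, -, H⟩ := hν
  -- Otherwise `{ν > 0}` has finite measure, `ν^*` vanishes at a larger volume `r`, and `ν^#(r) =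
  -- 0`, which injectivity of `w` forbids. The `+ 1` below keeps `r` nonzero.
  obtain ⟨x, hxR, hx⟩ : ∃ x, R ≤ ‖x‖ ∧ ν x ≠ 0 := by
    by_contra! hcon
    have hfin : volume {x | 0 < ν x} < ∞ := by
      refine (measure_mono (t := Metric.closedBall 0 R) fun x hx => ?_).trans_lt
        measure_closedBall_lt_top
      rw [mem_closedBall_zero_iff]
      by_contra! hR
      exact (show 0 < ν x from hx).ne' (hcon x hR.le)
    refine h.kernelSharp_ne_zero hp (r := volume {x | 0 < ν x} + 1) (by simp)
      (by simp [hfin.ne]) ?_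
    have : symmRearrangement ν (ballRadius d (volume {x | 0 < ν x} + 1)) = 0 := by
      rw [symmRearrangement_ballRadius hd, ← nonpos_iff_eq_zero]
      refine le_of_forall_gt_imp_ge_of_dense fun s hs => sInf_le ⟨hs, ?_⟩
      exact (measure_mono fun x hx => hs.trans hx).trans le_self_add
    simp [kernelSharp, this]
  -- The minimum with `1` keeps the bound finite, as `ν x` may be `∞`.
  refine ⟨(min (κ * ν x) 1).toNNReal, ?_, fun y hy hyR => ?_⟩
  · refine ENNReal.toNNReal_pos ?_ (by simp)
    exact (lt_min (ENNReal.mul_pos (by simpa using hκ.ne') hx) one_pos).ne'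
  · rw [ENNReal.coe_toNNReal (by simp)]
    exact (min_le_left _ _).trans (H x y hy (hyR.trans hxR))

end CriticalKernel

/-- Jensen's inequality, obtained as `L^1 ≤ L^p` for the normalised probability measure. -/
theorem enorm_sub_average_rpow_le {α : Type*} [MeasurableSpace α] {μ : Measure α}
    [IsFiniteMeasure μ] [NeZero μ] {p : ℝ} (hp : 1 ≤ p) {u : α → ℝ} (hu : Integrable u μ)
    (a : ℝ) :
    ‖a - ⨍ y, u y ∂μ‖ₑ ^ p ≤ (μ univ)⁻¹ * ∫⁻ y, ‖a - u y‖ₑ ^ p ∂μ := by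
  have hp0 : 0 < p := by positivity
  have hui : Integrable u ((μ univ)⁻¹ • μ) := hu.smul_measure (by simp [NeZero.ne μ])
  have h1 : a - ⨍ y, u y ∂μ = ∫ y, (a - u y) ∂((μ univ)⁻¹ • μ) := by
    rw [integral_sub (integrable_const _) hui]; simp [average]
  have h2 : eLpNorm (fun y => a - u y) 1 ((μ univ)⁻¹ • μ) ≤
      eLpNorm (fun y => a - u y) (ENNReal.ofReal p) ((μ univ)⁻¹ • μ) :=
    eLpNorm_le_eLpNorm_of_exponent_le (by simpa using hp)
      (aestronglyMeasurable_const.sub hui.1)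
  rw [eLpNorm_one_eq_lintegral_enorm, eLpNorm_eq_lintegral_rpow_enorm_toReal (by simpa using hp0)
    ENNReal.ofReal_ne_top, ENNReal.toReal_ofReal hp0.le] at h2
  have h3 := ENNReal.rpow_le_rpow ((enorm_integral_le_lintegral_enorm _).trans h2) hp0.le
  rwa [← ENNReal.rpow_mul, one_div_mul_cancel hp0.ne', ENNReal.rpow_one, lintegral_smul_measure,
    ← h1] at h3

/-! ### Poincaré inequality on `Ω` and transfer through the extension operator. -/

section ExtensionDomain

variable {d : ℕ} {p : ℝ} {ν : EuclideanSpace ℝ (Fin d) → ℝ≥0∞}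
  {Ω : Set (EuclideanSpace ℝ (Fin d))}

theorem nonlocalEnergy_sub_const (u : EuclideanSpace ℝ (Fin d) → ℝ) (a : ℝ) :
    nonlocalEnergy p ν Ω (fun x => u x - a) = nonlocalEnergy p ν Ω u := by
  simp only [nonlocalEnergy, sub_sub_sub_cancel_right]

theorem luxemburgNorm_le_of_ae_eq (φ : ℝ≥0∞ → ℝ≥0∞) {u v : EuclideanSpace ℝ (Fin d) → ℝ}
    (h : v =ᵐ[volume.restrict Ω] u) : luxemburgNorm φ Ω u ≤ luxemburgNorm φ univ v := by
  refine le_iInf₂ fun l hl => iInf₂_le l ⟨hl.1, ?_⟩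
  refine le_trans ?_ hl.2
  rw [Measure.restrict_univ]
  refine le_of_eq_of_le (lintegral_congr_ae ?_) (setLIntegral_le_lintegral Ω _)
  filter_upwards [h] with x hx
  rw [hx]

/-- The nonlocal Poincaré inequality on a bounded open set. -/
theorem CriticalKernel.exists_poincare (hd : 1 ≤ d) (hp : 1 ≤ p) (h : CriticalKernel p ν)
    (hν : AlmostDecreasing ν) (hΩ : IsOpen Ω) (hne : Ω.Nonempty) (hbdd : Bornology.IsBounded Ω) :
    ∃ D : ℝ≥0, ∀ u : EuclideanSpace ℝ (Fin d) → ℝ, IntegrableOn u Ω volume →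
      ∫⁻ x in Ω, ‖u x - ⨍ y in Ω, u y‖ₑ ^ p ≤ D * nonlocalEnergy p ν Ω u := by
  obtain ⟨c, hc, H⟩ := h.exists_le_of_norm_le hd hp hν (Metric.diam Ω)
  have hΩ0 : volume Ω ≠ 0 := (hΩ.measure_pos volume hne).ne'
  have hΩt : volume Ω < ∞ := hbdd.measure_lt_top
  have : IsFiniteMeasure (volume.restrict Ω) := ⟨by simpa using hΩt⟩
  have : NeZero (volume.restrict Ω) := ⟨by simpa using hΩ0⟩
  have : Nonempty (Fin d) := ⟨⟨0, hd⟩⟩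
  have hi0 : (volume Ω)⁻¹ ≠ ∞ := ENNReal.inv_ne_top.2 hΩ0
  have hcinv : (c : ℝ≥0∞)⁻¹ ≠ ∞ := ENNReal.inv_ne_top.2 (by simpa using hc.ne')
  refine ⟨((volume Ω)⁻¹ * (c : ℝ≥0∞)⁻¹).toNNReal, fun u hu => ?_⟩
  rw [ENNReal.coe_toNNReal (ENNReal.mul_ne_top hi0 hcinv), nonlocalEnergy,
    ← lintegral_const_mul' _ _ (ENNReal.mul_ne_top hi0 hcinv)]
  refine setLIntegral_mono' hΩ.measurableSet fun x hx => ?_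
  refine (enorm_sub_average_rpow_le hp hu (u x)).trans ?_
  rw [Measure.restrict_apply_univ, mul_assoc, ← lintegral_const_mul' _ _ hcinv]
  refine mul_le_mul' le_rfl (lintegral_mono_ae ?_)
  -- The lower bound says nothing about `ν 0`; the diagonal is null.
  have hxy : ∀ᵐ y ∂(volume.restrict Ω), y ≠ x := ae_restrict_of_ae (by simp [ae_iff])
  filter_upwards [hxy, ae_restrict_mem hΩ.measurableSet] with y hy hyΩ
  have h1 : c ≤ ν (x - y) := H _ (sub_ne_zero.2 hy.symm) (by
    rw [← dist_eq_norm]; exact Metric.dist_le_diam_of_mem hbdd hx hyΩ)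
  calc ‖u x - u y‖ₑ ^ p = (c : ℝ≥0∞)⁻¹ * (‖u x - u y‖ₑ ^ p * c) := by
        rw [mul_left_comm, ENNReal.inv_mul_cancel (by simpa using hc.ne') (by simp), mul_one]
    _ ≤ _ := by gcongr

theorem CriticalKernel.exists_sobolev_poincare (hd : 1 ≤ d) (hp : 1 ≤ p)
    (h : CriticalKernel p ν) (hν : AlmostDecreasing ν) (hne : Ω.Nonempty)
    (hbdd : Bornology.IsBounded Ω) (hΩ : IsExtensionDomain p ν Ω) :
    ∃ C : ℝ≥0, 0 < C ∧ ∀ u : EuclideanSpace ℝ (Fin d) → ℝ,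
      MemOrlicz (criticalFunction p ν) Ω u →
        IntegrableOn u Ω volume ∧
        luxemburgNorm (criticalFunction p ν) Ω (fun x => u x - ⨍ y in Ω, u y) ≤
          C * nonlocalSeminorm p ν Ω u := by
  obtain ⟨hopen, T, A, -, hT⟩ := hΩ
  obtain ⟨K, hK, hSob⟩ := h.exists_luxemburgNorm_le hd hp
  obtain ⟨D, hPoi⟩ := h.exists_poincare hd hp hν hopen hne hbdd
  have hp0 : 0 < p := by positivity
  have hp1 : (1 : ℝ≥0∞) ≤ ENNReal.ofReal p := by simpa using hp
  have hΩt : volume Ω < ∞ := hbdd.measure_lt_top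
  have : IsFiniteMeasure (volume.restrict Ω) := ⟨by simpa using hΩt⟩
  -- In `D + 1`, `D` bounds the `L^p` part and `1` the seminorm. The outer `+ 1` only ensures
  -- positivity, which also settles the case of infinite seminorm.
  refine ⟨K * (A * (D + 1) ^ (1 / p)) + 1, by positivity, fun u hu => ?_⟩
  have huL := h.memLp_of_memOrlicz hp hΩt.ne hu
  have hui : IntegrableOn u Ω volume := huL.integrable hp1
  refine ⟨hui, ?_⟩
  rcases eq_or_ne (nonlocalSeminorm p ν Ω u) ∞ with htop | hfin
  · rw [htop, ENNReal.mul_top (by simp)]; exact le_top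
  set v : EuclideanSpace ℝ (Fin d) → ℝ := fun x => u x - ⨍ y in Ω, u y with hvdef
  have hvs : nonlocalSeminorm p ν Ω v = nonlocalSeminorm p ν Ω u := by
    rw [nonlocalSeminorm, nonlocalEnergy_sub_const, nonlocalSeminorm]
  have hvm : MemNonlocalSobolev p ν Ω v :=
    ⟨huL.sub (memLp_const _), hvs ▸ hfin.lt_top⟩
  obtain ⟨hTm, hTeq, hTle⟩ := hT v hvm
  have hnorm : nonlocalSobolevNorm p ν Ω v ≤
      ((D + 1) ^ (1 / p) : ℝ≥0) * nonlocalSeminorm p ν Ω u := by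
    have hE : nonlocalSeminorm p ν Ω u ^ p = nonlocalEnergy p ν Ω u := by
      rw [nonlocalSeminorm, ← ENNReal.rpow_mul, one_div_mul_cancel hp0.ne', ENNReal.rpow_one]
    have hL : eLpNorm v (ENNReal.ofReal p) (volume.restrict Ω) ^ p =
        ∫⁻ x in Ω, ‖v x‖ₑ ^ p := by
      rw [eLpNorm_eq_lintegral_rpow_enorm_toReal (by simpa using hp0) ENNReal.ofReal_ne_top,
        ENNReal.toReal_ofReal hp0.le, ← ENNReal.rpow_mul, one_div_mul_cancel hp0.ne',
        ENNReal.rpow_one]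
    rw [nonlocalSobolevNorm, hvs, hE, hL, nonlocalSeminorm,
      ENNReal.coe_rpow_of_nonneg _ (by positivity), ← ENNReal.mul_rpow_of_nonneg _ _ (by positivity)]
    refine ENNReal.rpow_le_rpow ?_ (by positivity)
    push_cast
    rw [add_mul, one_mul]
    gcongr
    exact hPoi u hui
  have hsemi : nonlocalSeminorm p ν univ (T v) ≤ nonlocalSobolevNorm p ν univ (T v) := by
    rw [nonlocalSobolevNorm]
    calc _ = (nonlocalSeminorm p ν univ (T v) ^ p) ^ (1 / p) := by
          rw [← ENNReal.rpow_mul, mul_one_div_cancel hp0.ne', ENNReal.rpow_one]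
      _ ≤ _ := by gcongr; exact le_add_self
  calc luxemburgNorm (criticalFunction p ν) Ω v
      ≤ luxemburgNorm (criticalFunction p ν) univ (T v) := luxemburgNorm_le_of_ae_eq _ hTeq
    _ ≤ K * nonlocalSeminorm p ν univ (T v) := hSob _ (by simpa using hTm.1)
    _ ≤ K * (A * (((D + 1) ^ (1 / p) : ℝ≥0) * nonlocalSeminorm p ν Ω u)) := by
        gcongr
        exact hsemi.trans (hTle.trans (by gcongr))
    _ = ((K * (A * (D + 1) ^ (1 / p)) : ℝ≥0) : ℝ≥0∞) * nonlocalSeminorm p ν Ω u := by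
        simp only [ENNReal.coe_mul, mul_assoc]
    _ ≤ _ := by gcongr; exact le_self_add

end ExtensionDomain

/-! ### The fractional kernel. -/

theorem volume_enorm_lt {d : ℕ} (hd : 1 ≤ d) {t : ℝ≥0∞} (ht : t ≠ ∞) :
    volume {h : EuclideanSpace ℝ (Fin d) | ‖h‖ₑ < t} =
      volume (Metric.ball (0 : EuclideanSpace ℝ (Fin d)) 1) * t ^ d := by
  have : Nonempty (Fin d) := ⟨⟨0, hd⟩⟩
  lift t to ℝ≥0 using ht
  have hb : {h : EuclideanSpace ℝ (Fin d) | ‖h‖ₑ < t} = Metric.ball 0 t := by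
    ext h
    rw [mem_ball_zero_iff, mem_ofPred_eq, enorm_eq_nnnorm, ENNReal.coe_lt_coe, ← NNReal.coe_lt_coe,
      coe_nnnorm]
  rw [hb, Measure.addHaar_ball _ _ t.coe_nonneg, finrank_euclideanSpace_fin, mul_comm,
    ENNReal.ofReal_pow t.coe_nonneg, ENNReal.ofReal_coe_nnreal]

theorem rpow_neg_lt_rpow_neg_iff {a : ℝ} (ha : 0 < a) {s t : ℝ≥0∞} :
    s ^ (-a) < t ^ (-a) ↔ t < s := by
  rw [ENNReal.rpow_neg, ENNReal.rpow_neg, ENNReal.inv_lt_inv, ENNReal.rpow_lt_rpow_iff ha]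

section FractionalKernel

variable {d : ℕ} {s p : ℝ}

/-- The kernel is radially decreasing: its superlevel sets are balls, so it is its own
rearrangement. -/
theorem symmRearrangement_fractionalKernel (hd : 1 ≤ d) (ha : 0 < (d : ℝ) + s * p) {ρ : ℝ≥0∞}
    (ht : ρ ≠ ∞) :
    symmRearrangement (fractionalKernel d s p) ρ = ρ ^ (-((d : ℝ) + s * p)) := by
  have hc0 : volume (Metric.ball (0 : EuclideanSpace ℝ (Fin d)) 1) ≠ 0 :=
    (Metric.measure_ball_pos _ _ one_pos).ne'
  have hct : volume (Metric.ball (0 : EuclideanSpace ℝ (Fin d)) 1) ≠ ∞ := measure_ball_lt_top.ne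
  refine le_antisymm (sInf_le ⟨?_, ?_⟩) (le_sInf fun r hr => ?_)
  · rw [ENNReal.rpow_neg]
    exact ENNReal.inv_pos.2 (ENNReal.rpow_ne_top_of_nonneg ha.le ht)
  · simp only [fractionalKernel, rpow_neg_lt_rpow_neg_iff ha, volume_enorm_lt hd ht, le_refl]
  · by_contra! hlt
    set τ := r ^ (-(1 / ((d : ℝ) + s * p))) with hτ
    have hrτ : r = τ ^ (-((d : ℝ) + s * p)) := by
      rw [hτ, ← ENNReal.rpow_mul, neg_mul_neg, one_div_mul_cancel ha.ne', ENNReal.rpow_one]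
    have hτt : τ ≠ ∞ := by
      rw [hτ, ENNReal.rpow_neg]
      exact ENNReal.inv_ne_top.2 (by
        simp [hr.1.ne', (hlt.trans_le le_top).ne])
    rw [hrτ, rpow_neg_lt_rpow_neg_iff ha] at hlt
    have h2 := hr.2
    rw [hrτ] at h2
    simp only [fractionalKernel, rpow_neg_lt_rpow_neg_iff ha, volume_enorm_lt hd hτt] at h2
    rw [ENNReal.mul_le_mul_iff_right hc0 hct] at h2
    exact absurd h2 (not_le.2 (ENNReal.pow_lt_pow_left (by omega) hlt))

/-- Substitution `h ↦ ρ h`: the Jacobian `ρ^d` meets the homogeneity `ρ^{-d-sp}`. -/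
theorem lintegral_fractionalKernel_enorm_gt (ha : 0 < (d : ℝ) + s * p) {ρ : ℝ≥0}
    (h0 : ρ ≠ 0) :
    ∫⁻ h in {h | (ρ : ℝ≥0∞) < ‖h‖ₑ}, fractionalKernel d s p h =
      (ρ : ℝ≥0∞) ^ (-(s * p)) * ∫⁻ h in {h | 1 < ‖h‖ₑ}, fractionalKernel d s p h := by
  have hm (t : ℝ≥0∞) : MeasurableSet {h : EuclideanSpace ℝ (Fin d) | t < ‖h‖ₑ} :=
    measurableSet_lt measurable_const measurable_enorm
  have hfm : Measurable (fractionalKernel d s p) := measurable_enorm.pow_const _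
  have hρ : (ρ : ℝ) ≠ 0 := by exact_mod_cast h0
  have hmap := Measure.map_addHaar_smul (volume : Measure (EuclideanSpace ℝ (Fin d))) hρ
  have hc : ENNReal.ofReal |((ρ : ℝ) ^ Module.finrank ℝ (EuclideanSpace ℝ (Fin d)))⁻¹| =
      ((ρ : ℝ≥0∞) ^ d)⁻¹ := by
    rw [finrank_euclideanSpace_fin, abs_of_nonneg (by positivity),
      ENNReal.ofReal_inv_of_pos (by positivity), ENNReal.ofReal_pow ρ.coe_nonneg, ENNReal.ofReal_coe_nnreal]
  rw [hc] at hmap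
  have hsm : Measurable fun h : EuclideanSpace ℝ (Fin d) => (ρ : ℝ) • h := measurable_const_smul _
  have hpre : (fun h : EuclideanSpace ℝ (Fin d) => (ρ : ℝ) • h) ⁻¹' {h | (ρ : ℝ≥0∞) < ‖h‖ₑ} =
      {h | 1 < ‖h‖ₑ} := by
    ext h
    rw [mem_preimage, mem_ofPred_eq, mem_ofPred_eq, enorm_smul, Real.enorm_of_nonneg ρ.coe_nonneg,
      ENNReal.ofReal_coe_nnreal]
    nth_rw 1 [← mul_one (ρ : ℝ≥0∞)]
    rw [ENNReal.mul_lt_mul_iff_right (by simpa using h0) (by simp)]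
  have key := setLIntegral_map (μ := volume) (hm ρ) hfm hsm
  rw [hmap, hpre, Measure.restrict_smul, lintegral_smul_measure] at key
  have hval (h : EuclideanSpace ℝ (Fin d)) : fractionalKernel d s p ((ρ : ℝ) • h) =
      (ρ : ℝ≥0∞) ^ (-((d : ℝ) + s * p)) * fractionalKernel d s p h := by
    rw [fractionalKernel, fractionalKernel, enorm_smul, Real.enorm_of_nonneg ρ.coe_nonneg,
      ENNReal.ofReal_coe_nnreal]
    simp only [ENNReal.rpow_neg]
    rw [ENNReal.mul_rpow_of_nonneg _ _ ha.le,
      ENNReal.mul_inv (Or.inl (by simp [h0])) (Or.inl (by simp [h0]))]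
  simp only [hval] at key
  rw [lintegral_const_mul' _ _ (by simp [h0])] at key
  have hd0 : (ρ : ℝ≥0∞) ^ d ≠ 0 := by simp [h0]
  have hdt : (ρ : ℝ≥0∞) ^ d ≠ ∞ := by simp
  calc _ = (ρ : ℝ≥0∞) ^ d * (((ρ : ℝ≥0∞) ^ d)⁻¹ •
        ∫⁻ h in {h | (ρ : ℝ≥0∞) < ‖h‖ₑ}, fractionalKernel d s p h) := by
        rw [smul_eq_mul, ← mul_assoc, ENNReal.mul_inv_cancel hd0 hdt, one_mul]
    _ = _ := by
        rw [key, ← mul_assoc, ← ENNReal.rpow_natCast, ← ENNReal.rpow_add _ _ (by simpa using h0)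
          (by simp)]
        congr 2
        ring

/-- Comparison with the integrable `(1 + |h|)^{-d-sp}`, using `1 + |h| ≤ 2|h|` on the domain. -/
theorem lintegral_fractionalKernel_ne_top (hsp : 0 < s * p) :
    ∫⁻ h in {h : EuclideanSpace ℝ (Fin d) | 1 < ‖h‖ₑ}, fractionalKernel d s p h ≠ ∞ := by
  have ha : 0 < (d : ℝ) + s * p := by positivity
  have hfin := finite_integral_one_add_norm (E := EuclideanSpace ℝ (Fin d)) (μ := volume)
    (r := (d : ℝ) + s * p) (by rw [finrank_euclideanSpace_fin]; linarith)
  have hm : MeasurableSet {h : EuclideanSpace ℝ (Fin d) | 1 < ‖h‖ₑ} :=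
    measurableSet_lt measurable_const measurable_enorm
  have hC : (2 : ℝ≥0∞) ^ ((d : ℝ) + s * p) ≠ ∞ := ENNReal.rpow_ne_top_of_nonneg ha.le (by simp)
  refine ((setLIntegral_mono' (g := fun h => 2 ^ ((d : ℝ) + s * p) *
    ENNReal.ofReal ((1 + ‖h‖) ^ (-((d : ℝ) + s * p)))) hm fun h hh => ?_).trans_lt
    ((setLIntegral_le_lintegral _ _).trans_lt ?_)).ne
  · have hh' : (1 : ℝ≥0∞) ≤ ‖h‖ₑ := le_of_lt hh
    have hM : ENNReal.ofReal (1 + ‖h‖) ≤ 2 * ‖h‖ₑ := by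
      rw [ENNReal.ofReal_add zero_le_one (norm_nonneg h), ofReal_norm, ENNReal.ofReal_one, two_mul]
      gcongr
    rw [← ENNReal.ofReal_rpow_of_pos (by positivity), fractionalKernel, ENNReal.rpow_neg,
      ENNReal.rpow_neg]
    calc (‖h‖ₑ ^ ((d : ℝ) + s * p))⁻¹
        = 2 ^ ((d : ℝ) + s * p) * ((2 * ‖h‖ₑ) ^ ((d : ℝ) + s * p))⁻¹ := by
          rw [ENNReal.mul_rpow_of_nonneg _ _ ha.le, ENNReal.mul_inv (Or.inl (by simp))
            (Or.inl hC), ← mul_assoc, ENNReal.mul_inv_cancel (by simp) hC, one_mul]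
      _ ≤ _ := by gcongr
  · rw [lintegral_const_mul' _ _ hC]
    exact ENNReal.mul_lt_top hC.lt_top hfin

theorem lintegral_fractionalKernel_ne_zero (hd : 1 ≤ d) (ha : 0 < (d : ℝ) + s * p) :
    ∫⁻ h in {h : EuclideanSpace ℝ (Fin d) | 1 < ‖h‖ₑ}, fractionalKernel d s p h ≠ 0 := by
  have hfm : Measurable (fractionalKernel d s p) := measurable_enorm.pow_const _
  refine ((setLIntegral_pos_iff hfm).2 ?_).ne'
  have hsupp : Function.support (fractionalKernel d s p) = univ := by
    refine Function.support_eq_univ fun h => ?_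
    rw [fractionalKernel, ENNReal.rpow_neg]
    exact ENNReal.inv_ne_zero.2 (ENNReal.rpow_ne_top_of_nonneg ha.le enorm_ne_top)
  rw [hsupp, univ_inter]
  refine IsOpen.measure_pos _ (isOpen_lt continuous_const continuous_enorm) ?_
  refine ⟨EuclideanSpace.single ⟨0, hd⟩ 2, ?_⟩
  rw [mem_ofPred_eq, ← ofReal_norm, PiLp.norm_single]
  simp

/-- Here `ν^#(r) = J η(r)^{-sp}` is a multiple of `r^{-sp/d}`, so the exponent of `w` is `(1 -
sp/d)/p = 1/p - s/d`. -/
theorem exists_kernelW_fractionalKernel (hd : 1 ≤ d) (hp : 1 ≤ p) (hs : 0 < s)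
    (hq : 0 < sobolevExponent d s p) :
    ∃ K : ℝ≥0, 0 < K ∧ ∀ r, kernelW p (fractionalKernel d s p) r =
      K * r ^ (1 / sobolevExponent d s p) := by
  have hp0 : 0 < p := by positivity
  have hsp : 0 < s * p := by positivity
  have hd0 : 0 < (d : ℝ) := by positivity
  have ha : 0 < (d : ℝ) + s * p := by positivity
  set J := ∫⁻ h in {h : EuclideanSpace ℝ (Fin d) | 1 < ‖h‖ₑ}, fractionalKernel d s p h with hJ
  set b := volume (Metric.ball (0 : EuclideanSpace ℝ (Fin d)) 1) with hb
  have hb0 : b ≠ 0 := (Metric.measure_ball_pos _ _ one_pos).ne'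
  have hbt : b ≠ ∞ := measure_ball_lt_top.ne
  have hJ0 : J ≠ 0 := lintegral_fractionalKernel_ne_zero hd ha
  have hJt : J ≠ ∞ := lintegral_fractionalKernel_ne_top hsp
  have hB0 : b ^ (s * p / d) ≠ 0 := by simp [hb0, hbt]
  have hBt : b ^ (s * p / d) ≠ ∞ := by simp [hb0, hbt]
  have hK0 : (J * b ^ (s * p / d)) ^ (1 / p) ≠ 0 := by
    simp only [ne_eq, ENNReal.rpow_eq_zero_iff, mul_eq_zero, hJ0, hB0, ENNReal.mul_eq_top]
    simp [hJt, hBt]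
  have hKt : (J * b ^ (s * p / d)) ^ (1 / p) ≠ ∞ :=
    ENNReal.rpow_ne_top_of_nonneg (by positivity) (ENNReal.mul_ne_top hJt hBt)
  refine ⟨((J * b ^ (s * p / d)) ^ (1 / p)).toNNReal, ENNReal.toNNReal_pos hK0 hKt, fun r => ?_⟩
  rw [ENNReal.coe_toNNReal hKt]
  have hq' : 0 < 1 / sobolevExponent d s p := by positivity
  rcases eq_or_ne r ∞ with rfl | hrt
  · rw [kernelW_top, ENNReal.top_rpow_of_pos hq', ENNReal.mul_top hK0]
  rcases eq_or_ne r 0 with rfl | hr0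
  · rw [kernelW_zero hp, ENNReal.zero_rpow_of_pos hq', mul_zero]
  have hrb0 : r / b ≠ 0 := (ENNReal.div_pos hr0 hbt).ne'
  have hrbt : r / b ≠ ∞ := (ENNReal.div_lt_top hrt hb0).ne
  have hρ0 : ballRadius d r ≠ 0 := by rw [ballRadius, ← hb]; simp [hrb0, hrbt]
  have hρt : ballRadius d r ≠ ∞ := by rw [ballRadius, ← hb]; simp [hrb0, hrbt]
  have hsharp : kernelSharp (fractionalKernel d s p) r = ballRadius d r ^ (-(s * p)) * J := by
    rw [kernelSharp, symmRearrangement_fractionalKernel hd ha hρt]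
    simp only [fractionalKernel, rpow_neg_lt_rpow_neg_iff ha]
    lift ballRadius d r to ℝ≥0 using hρt with ρ
    exact lintegral_fractionalKernel_enorm_gt ha (by simpa using hρ0)
  have hexp : r * (r / b) ^ (-(s * p / d)) = b ^ (s * p / d) * r ^ (1 - s * p / d) := by
    rw [ENNReal.rpow_neg, div_eq_mul_inv, ENNReal.mul_rpow_of_nonneg _ _ (by positivity),
      ENNReal.inv_rpow, ENNReal.mul_inv (by simp [hr0, hrt]) (by simp [hb0, hbt]), inv_inv,
      sub_eq_add_neg, ENNReal.rpow_add _ _ hr0 hrt, ENNReal.rpow_one, ENNReal.rpow_neg]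
    ring
  have h1 : 0 ≤ 1 / p := by positivity
  rw [kernelW, if_neg hrt, hsharp, ballRadius, ← hb, ← ENNReal.rpow_mul,
    show 1 / (d : ℝ) * -(s * p) = -(s * p / d) by ring, ← mul_assoc, hexp,
    mul_right_comm, mul_comm (b ^ _), ENNReal.mul_rpow_of_nonneg _ _ h1, ← ENNReal.rpow_mul]
  congr 2
  rw [sobolevExponent]
  field_simp

theorem bijective_kernelW_fractionalKernel {K : ℝ≥0} {q : ℝ} (hK : 0 < K) (hq : 0 < q)
    {ν : EuclideanSpace ℝ (Fin d) → ℝ≥0∞} (h : ∀ r, kernelW p ν r = K * r ^ (1 / q)) :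
    Function.Bijective (kernelW p ν) ∧ ∀ t, criticalFunction p ν t = (K * t) ^ q := by
  have hK0 : (K : ℝ≥0∞) ≠ 0 := by simpa using hK.ne'
  have hinj : Function.Injective (kernelW p ν) := by
    intro a b hab
    rw [h, h, ENNReal.mul_right_inj hK0 (by simp)] at hab
    exact ENNReal.rpow_left_injective (by positivity) hab
  have hr (t : ℝ≥0∞) : kernelW p ν ((K * t) ^ q)⁻¹ = t⁻¹ := by
    rw [h, ENNReal.inv_rpow, ← ENNReal.rpow_mul, mul_one_div_cancel hq.ne', ENNReal.rpow_one,
      ENNReal.mul_inv (by simp [hK0]) (by simp), ← mul_assoc, ENNReal.mul_inv_cancel hK0 (by simp),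
      one_mul]
  refine ⟨⟨hinj, fun t => ⟨_, (hr t⁻¹).trans (inv_inv t)⟩⟩, fun t => ?_⟩
  rw [criticalFunction, ← hr t, Function.leftInverse_invFun hinj, inv_inv]

theorem isYoungFunction_mul_rpow {K : ℝ≥0} {q : ℝ} (hp : 1 ≤ p) (hpq : p ≤ q) :
    IsYoungFunction fun t => ((K : ℝ≥0∞) * t ^ (1 / p)) ^ q := by
  have hp0 : 0 < p := by positivity
  have hq0 : 0 < q := by linarith
  refine ⟨by simp [hp0, hq0], convex_univ, fun x _ y _ a b _ _ hab => ?_⟩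
  have hab' : (a : ℝ≥0∞) + b = 1 := by exact_mod_cast hab
  have hr (t : ℝ≥0∞) : ((K : ℝ≥0∞) * t ^ (1 / p)) ^ q = K ^ q * t ^ (q / p) := by
    rw [ENNReal.mul_rpow_of_nonneg _ _ hq0.le, ← ENNReal.rpow_mul, one_div_mul_eq_div]
  simp only [hr, ENNReal.smul_def, smul_eq_mul]
  calc (K : ℝ≥0∞) ^ q * (a * x + b * y) ^ (q / p)
      ≤ K ^ q * (a * x ^ (q / p) + b * y ^ (q / p)) := by
        gcongr
        exact ENNReal.rpow_arith_mean_le_arith_mean2_rpow _ _ _ _ hab' ((one_le_div hp0).2 hpq)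
    _ = _ := by ring

theorem criticalKernel_fractionalKernel (hd : 1 ≤ d) (hp : 1 ≤ p) (hs : 0 < s)
    (hq : 0 < sobolevExponent d s p) :
    CriticalKernel p (fractionalKernel d s p) ∧ ∃ K : ℝ≥0, 0 < K ∧
      ∀ t, criticalFunction p (fractionalKernel d s p) t = (K * t) ^ sobolevExponent d s p := by
  obtain ⟨K, hK, hw⟩ := exists_kernelW_fractionalKernel hd hp hs hq
  obtain ⟨hbij, hφ⟩ := bijective_kernelW_fractionalKernel hK hq hw
  have hK0 : (K : ℝ≥0∞) ≠ 0 := by simpa using hK.ne'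
  have hp0 : 0 < p := by positivity
  have hd0 : 0 < (d : ℝ) := by positivity
  have hpq : p ≤ sobolevExponent d s p := by
    have hpos : 0 < 1 / p - s / d := one_div_pos.1 hq
    rw [sobolevExponent, le_one_div hp0 hpos]
    have : 0 < s / d := by positivity
    linarith
  -- With `θ = 1/K` the growth condition is an equality: both sides are `(s/t)^q`.
  refine ⟨⟨(measurable_enorm.pow_const _).aemeasurable, hbij, ?_, K⁻¹, by positivity, ?_⟩,
    K, hK, hφ⟩
  · simp only [hφ]
    exact isYoungFunction_mul_rpow hp hpq
  · intro a t ht htt _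
    rw [hφ, hφ, hφ, ← ENNReal.div_rpow_of_nonneg _ _ hq.le, ENNReal.coe_inv hK.ne', ← mul_assoc,
      ENNReal.mul_inv_cancel hK0 (by simp), one_mul, ENNReal.mul_div_mul_left _ _ hK0 (by simp)]

theorem almostDecreasing_fractionalKernel (ha : 0 < (d : ℝ) + s * p) :
    AlmostDecreasing (fractionalKernel d s p) := by
  refine ⟨1, one_pos, le_rfl, fun x y _ hxy => ?_⟩
  have : ‖y‖ₑ ≤ ‖x‖ₑ := enorm_le_iff_norm_le.2 hxy
  rw [ENNReal.coe_one, one_mul, fractionalKernel, fractionalKernel, ENNReal.rpow_neg,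
    ENNReal.rpow_neg]
  gcongr

end FractionalKernel

/-! ### From power-type Orlicz spaces to `L^q`, and the final theorem. -/

theorem memOrlicz_mul_rpow {d : ℕ} {K : ℝ≥0} {q : ℝ} (hq : 0 < q) {φ : ℝ≥0∞ → ℝ≥0∞}
    (hφ : ∀ t, φ t = (K * t) ^ q) {Ω : Set (EuclideanSpace ℝ (Fin d))}
    {u : EuclideanSpace ℝ (Fin d) → ℝ} (hu : MemLp u (ENNReal.ofReal q) (volume.restrict Ω)) :
    MemOrlicz φ Ω u := by
  refine ⟨hu.1, 1, one_pos, ?_⟩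
  have h := (eLpNorm_lt_top_iff_lintegral_rpow_enorm_lt_top (by simpa using hq)
    ENNReal.ofReal_ne_top).1 hu.2
  rw [ENNReal.toReal_ofReal hq.le] at h
  have hK : (K : ℝ≥0∞) ^ q ≠ ∞ := ENNReal.rpow_ne_top_of_nonneg hq.le (by simp)
  simp only [hφ, ENNReal.coe_one, div_one, ENNReal.mul_rpow_of_nonneg _ _ hq.le]
  rw [lintegral_const_mul' _ _ hK]
  exact ENNReal.mul_lt_top hK.lt_top h

theorem mul_eLpNorm_le_luxemburgNorm {d : ℕ} {K : ℝ≥0} {q : ℝ} (hq : 0 < q)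
    {φ : ℝ≥0∞ → ℝ≥0∞} (hφ : ∀ t, φ t = (K * t) ^ q) (Ω : Set (EuclideanSpace ℝ (Fin d)))
    (u : EuclideanSpace ℝ (Fin d) → ℝ) :
    K * eLpNorm u (ENNReal.ofReal q) (volume.restrict Ω) ≤ luxemburgNorm φ Ω u := by
  refine le_iInf₂ fun l ⟨hl, hle⟩ => ?_
  have hl0 : (l : ℝ≥0∞) ≠ 0 := by simpa using hl.ne'
  have hc : ((K : ℝ≥0∞) / l) ^ q ≠ ∞ :=
    ENNReal.rpow_ne_top_of_nonneg hq.le (ENNReal.div_lt_top (by simp) hl0).ne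
  have hpt (x) : φ (‖u x‖ₑ / l) = ((K : ℝ≥0∞) / l) ^ q * ‖u x‖ₑ ^ q := by
    rw [hφ, ← ENNReal.mul_rpow_of_nonneg _ _ hq.le, ENNReal.mul_div_right_comm.symm, mul_div_assoc]
  simp only [hpt] at hle
  rw [lintegral_const_mul' _ _ hc] at hle
  have h2 := ENNReal.rpow_le_rpow hle (z := 1 / q) (by positivity)
  rw [ENNReal.mul_rpow_of_nonneg _ _ (by positivity), ENNReal.one_rpow, ← ENNReal.rpow_mul,
    mul_one_div_cancel hq.ne', ENNReal.rpow_one] at h2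
  rw [eLpNorm_eq_lintegral_rpow_enorm_toReal (by simpa using hq) ENNReal.ofReal_ne_top,
    ENNReal.toReal_ofReal hq.le]
  rw [← ENNReal.mul_div_right_comm, ENNReal.div_le_iff hl0 (by simp), one_mul] at h2
  exact h2

theorem mainTheorem11 {d : ℕ} (hd : 1 ≤ d) (p : ℝ) (hp : 1 ≤ p)
    (Ω : Set (EuclideanSpace ℝ (Fin d))) (hne : Ω.Nonempty) (hbdd : Bornology.IsBounded Ω) :
    (∀ ν : EuclideanSpace ℝ (Fin d) → ℝ≥0∞,
      CriticalKernel p ν → AlmostDecreasing ν → IsExtensionDomain p ν Ω →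
      ∃ C : ℝ≥0, 0 < C ∧ ∀ u : EuclideanSpace ℝ (Fin d) → ℝ,
        MemOrlicz (criticalFunction p ν) Ω u →
          IntegrableOn u Ω volume ∧
          luxemburgNorm (criticalFunction p ν) Ω (fun x => u x - ⨍ y in Ω, u y) ≤
            C * nonlocalSeminorm p ν Ω u) ∧
    (∀ s : ℝ, 0 < s → s < 1 → 0 < sobolevExponent d s p →
      IsExtensionDomain p (fractionalKernel d s p) Ω →
      ∃ C : ℝ≥0, 0 < C ∧ ∀ u : EuclideanSpace ℝ (Fin d) → ℝ,
        MemLp u (ENNReal.ofReal (sobolevExponent d s p)) (volume.restrict Ω) →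
          IntegrableOn u Ω volume ∧
          eLpNorm (fun x => u x - ⨍ y in Ω, u y) (ENNReal.ofReal (sobolevExponent d s p))
              (volume.restrict Ω) ≤
            C * nonlocalSeminorm p (fractionalKernel d s p) Ω u) := by
  refine ⟨fun ν h hν hΩ => h.exists_sobolev_poincare hd hp hν hne hbdd hΩ,
    fun s hs _ hq hΩ => ?_⟩
  have hp0 : 0 < p := by positivity
  obtain ⟨hcrit, K, hK, hφ⟩ := criticalKernel_fractionalKernel hd hp hs hq
  obtain ⟨C, hC, H⟩ := hcrit.exists_sobolev_poincare hd hp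
    (almostDecreasing_fractionalKernel (by positivity)) hne hbdd hΩ
  have hK0 : (K : ℝ≥0∞) ≠ 0 := by simpa using hK.ne'
  refine ⟨K⁻¹ * C, by positivity, fun u hu => ?_⟩
  obtain ⟨hui, hle⟩ := H u (memOrlicz_mul_rpow hq hφ hu)
  refine ⟨hui, ?_⟩
  have h1 := (mul_eLpNorm_le_luxemburgNorm hq hφ Ω _).trans hle
  rw [ENNReal.coe_mul, ENNReal.coe_inv hK.ne', mul_assoc]
  calc _ = (K : ℝ≥0∞)⁻¹ * (K * eLpNorm (fun x => u x - ⨍ y in Ω, u y)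
        (ENNReal.ofReal (sobolevExponent d s p)) (volume.restrict Ω)) := by
        rw [← mul_assoc, ENNReal.inv_mul_cancel hK0 (by simp), one_mul]
    _ ≤ _ := by gcongr
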